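/- Let $X=[x_1,\dots,x_p]\in\mathbb R^{n\times p}$ with $p\ge 1$, let $\bar X\in\mathbb R^{n\times p^2}$ have the columns $x_j\odot x_k$ ($1\le j,k\le p$, entrywise products), and assume that no $x_j$ and no $x_j\odot x_k$ is zero. Let $y=Xb^*+\bar X\,\mathrm{vec}(\Phi^*)+\varepsilon$ with $\varepsilon\sim N(0,\sigma^2 I)$, $\sigma>0$, $b^*\in\mathbb R^p$, $\Phi^*\in\mathbb R^{p\times p}$. Let $X^s$ and $\bar X^s$ be $X$ and $\bar X$ with every column divided by its Euclidean norm, and $\breve X^s=[X^s,\bar X^s]$. For $b\in\mathbb R^p$, $\Phi\in\mathbb R^{p\times p}$ write $\Omega=[b,\Phi^\top]^\top$, with columns $\Omega_j=[b_j,\phi_j^\top]^\top$ where $\phi_j$ is the $j$-th column of $\Phi$; $\|\Omega^\top\|_{2,1}=\sum_j\|\Omega_j\|_2$; $M(b,\Phi)=\|Xb+\bar X\mathrm{vec}(\Phi)\|_2^2$; $\mathcal J_e(\Phi)$ for the support of $\mathrm{vec}(\Phi)$; $\mathcal J_G(b,\Phi)=\{j:b_j^2+\|\phi_j\|_2^2\ne0\}$;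 and $J_e,J_G$ for the cardinalities of these sets. $\|\breve X^s\|_2$ is the spectral norm. Let $(\hat b^s,\hat\Phi^s)$ be a (measurable) global minimizer of the scaled Type-B problem $$\min_{b,\ \Phi=\Phi^\top}\ \tfrac12\|y-X^sb-\bar X^s\mathrm{vec}(\Phi)\|_2^2+\lambda_1\|\breve X^s\|_2\|\Phi\|_1+\lambda_2\|\breve X^s\|_2\|\Omega^\top\|_{2,1},$$ where $\|\Phi\|_1=\sum_{j,k}|\phi_{jk}|$, $\lambda_i=A_i\sigma\sqrt{\log(ep)}$, and let $(\hat b,\hat\Phi)$ be the corresponding coefficients in the unscaled design: $\hat b_j=\hat b^s_j/\|x_j\|_2$, $\hat\phi_{jk}=\hat\phi^s_{jk}/\|x_j\odot x_k\|_2$. Let $\hat J_e=J_e(\hat\Phi)$, $\hat J_G=J_G(\hat b,\hat\Phi)$. Condition $\mathcal A'(\mathcal J_e,\mathcal J_G,\vartheta,\kappa)$: for all $\Delta=[\Delta_b,\Delta_\Phi^\top]^\top$ with $\Delta_\Phi=\Delta_\Phi^\top$ and $$\|(\Delta_\Phi)_{\mathcal J_e^c}\|_1+\|(\Delta_{\mathcal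 J_G^c})^\top\|_{2,1}\le(1+\vartheta)\bigl(\|(\Delta_\Phi)_{\mathcal J_e}\|_1+\|(\Delta_{\mathcal J_G})^\top\|_{2,1}\bigr),$$ where $\Delta_{\mathcal J_G}$ consists of the columns of $\Delta$ in $\mathcal J_G$ and $(\Delta_\Phi)_{\mathcal J_e}$ of the entries of $\mathrm{vec}(\Delta_\Phi)$ in $\mathcal J_e$, one has $$\kappa\|\breve X^s\|_2^2\bigl(\|(\Delta_\Phi)_{\mathcal J_e}\|_2^2+\|\Delta_{\mathcal J_G}\|_F^2\bigr)\le\|X^s\Delta_b+\bar X^s\mathrm{vec}(\Delta_\Phi)\|_2^2 .$$ Theorem. There is a universal constant $A_0>0$ such that for all $A_1,A_2\ge A_0$ there is a constant $C>0$ depending only on $A_1,A_2$ with the following property. In the setting above, let $b\in\mathbb R^p$ and let $\Phi\in\mathbb R^{p\times p}$ be symmetric, and suppose that $\mathcal A'(\mathcal J_e(\Phi),\mathcal J_G(b,\Phi),\vartheta,\kappa)$ holds for some $\kappa>0$ and some $\vartheta\ge0$ with $\max(A_1,A_2)\le(1+\vartheta)\min(A_1,A_2)$ (any $\vartheta\ge0$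 if $A_1=A_2$). Then, with $J_e=J_e(\Phi)$, $J_G=J_G(b,\Phi)$, if $p\ge2$, $$\mathbb E\,M(\hat b-b^*,\hat\Phi-\Phi^*)\le C\Bigl\{M(b-b^*,\Phi-\Phi^*)+\bigl(1\vee\tfrac1\kappa\bigr)\sigma^2(J_e+J_G)\log p+\sigma^2\Bigr\},$$ and, for all $p\ge1$, $$\mathbb E[\hat J_e]+\mathbb E[\hat J_G]\le C\Bigl\{\frac{M(b^*-b,\Phi^*-\Phi)+\sigma^2}{\sigma^2\log(ep)}+\bigl(1\vee\tfrac1\kappa\bigr)(J_e+J_G)\Bigr\}.$$ -/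

import Mathlib

open MeasureTheory ProbabilityTheory
open scoped Matrix

namespace Gresh

/-- The Euclidean norm of a real vector. -/
noncomputable def l2norm {ι : Type*} [Fintype ι] (v : ι → ℝ) : ℝ :=
  ‖(WithLp.toLp 2 v : EuclideanSpace ℝ ι)‖

open scoped Matrix.Norms.L2Operator in
/-- The spectral norm of a real matrix. -/
noncomputable def specNorm {n ι : Type*} [Fintype n] [Fintype ι] [DecidableEq ι]
    (A : Matrix n ι ℝ) : ℝ :=
  ‖A‖

/-- The column-scaled matrix: every nonzero column is divided by its Euclidean norm. -/
noncomputable def colScale {n ι : Type*} [Fintype n] (A : Matrix n ι ℝ) : Matrix n ι ℝ :=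
  Matrix.of fun i j => A i j / l2norm (A.col j)

/-- The `n × p²` matrix of all interactions; the column with index `(j, k)` is the entrywise
product of the columns `j` and `k` of `X`. Its columns are indexed as the entries of
`Matrix.vec Φ`, where `Φ.vec (j, k) = Φ k j`. -/
def interactions {n p : ℕ} (X : Matrix (Fin n) (Fin p) ℝ) :
    Matrix (Fin n) (Fin p × Fin p) ℝ :=
  Matrix.of fun i jk => X i jk.1 * X i jk.2

/-- The scaled main effects `Xˢ`. -/
noncomputable def mainS {n p : ℕ} (X : Matrix (Fin n) (Fin p) ℝ) : Matrix (Fin n) (Fin p) ℝ :=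
  colScale X

/-- The scaled interactions. -/
noncomputable def interactionsS {n p : ℕ} (X : Matrix (Fin n) (Fin p) ℝ) :
    Matrix (Fin n) (Fin p × Fin p) ℝ :=
  colScale (interactions X)

/-- The scaled overall design with all `p² + p` predictors. Only its spectral norm is used,
which does not depend on the order of the columns. -/
noncomputable def fullS {n p : ℕ} (X : Matrix (Fin n) (Fin p) ℝ) :
    Matrix (Fin n) (Fin p ⊕ Fin p × Fin p) ℝ :=
  Matrix.fromCols (mainS X) (interactionsS X)

/-- The fitted signal `X b + X̄ vec(Φ)`, in the original (unscaled) design. -/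
def signal {n p : ℕ} (X : Matrix (Fin n) (Fin p) ℝ) (b : Fin p → ℝ)
    (Φ : Matrix (Fin p) (Fin p) ℝ) : Fin n → ℝ :=
  X *ᵥ b + interactions X *ᵥ Φ.vec

/-- The fitted signal `Xˢ b + X̄ˢ vec(Φ)`, in the scaled design. -/
noncomputable def signalS {n p : ℕ} (X : Matrix (Fin n) (Fin p) ℝ) (b : Fin p → ℝ)
    (Φ : Matrix (Fin p) (Fin p) ℝ) : Fin n → ℝ :=
  mainS X *ᵥ b + interactionsS X *ᵥ Φ.vec

/-- `M(b, Φ) = ‖X b + X̄ vec(Φ)‖₂²`. -/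
noncomputable def predM {n p : ℕ} (X : Matrix (Fin n) (Fin p) ℝ) (b : Fin p → ℝ)
    (Φ : Matrix (Fin p) (Fin p) ℝ) : ℝ :=
  l2norm (signal X b Φ) ^ 2

/-- The concatenated `(p + 1) × p` coefficient matrix `Ω`, whose `j`-th column is `[b_j, φ_jᵀ]ᵀ`,
where `φ_j` is the `j`-th column of `Φ`. -/
def concat {p : ℕ} (b : Fin p → ℝ) (Φ : Matrix (Fin p) (Fin p) ℝ) :
    Matrix (Unit ⊕ Fin p) (Fin p) ℝ :=
  Matrix.fromRows (Matrix.replicateRow Unit b) Φ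

/-- The support of `vec(Φ)`. -/
noncomputable def Je {p : ℕ} (Φ : Matrix (Fin p) (Fin p) ℝ) : Finset (Fin p × Fin p) :=
  Finset.univ.filter fun jk => Φ.vec jk ≠ 0

/-- The group support `{j : b_j² + ‖φ_j‖₂² ≠ 0}`. -/
noncomputable def JG {p : ℕ} (b : Fin p → ℝ) (Φ : Matrix (Fin p) (Fin p) ℝ) : Finset (Fin p) :=
  Finset.univ.filter fun j => b j ^ 2 + l2norm (Φ.col j) ^ 2 ≠ 0

/-- The penalty `l₁ ‖Φ‖₁ + l₂ ‖Ωᵀ‖_{2,1}`. -/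
noncomputable def penalty {p : ℕ} (l₁ l₂ : ℝ) (b : Fin p → ℝ) (Φ : Matrix (Fin p) (Fin p) ℝ) :
    ℝ :=
  l₁ * ∑ jk, |Φ.vec jk| + l₂ * ∑ j, l2norm ((concat b Φ).col j)

/-- The objective function of the scaled Type-B problem. -/
noncomputable def typeBObjective {n p : ℕ} (X : Matrix (Fin n) (Fin p) ℝ) (y : Fin n → ℝ)
    (l₁ l₂ : ℝ) (b : Fin p → ℝ) (Φ : Matrix (Fin p) (Fin p) ℝ) : ℝ :=
  1 / 2 * l2norm (y - signalS X b Φ) ^ 2 +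
    penalty (l₁ * specNorm (fullS X)) (l₂ * specNorm (fullS X)) b Φ

/-- `(b, Φ)` is a global minimizer of the scaled Type-B problem, subject to `Φ = Φᵀ`. -/
def IsTypeBMinimizer {n p : ℕ} (X : Matrix (Fin n) (Fin p) ℝ) (y : Fin n → ℝ)
    (l₁ l₂ : ℝ) (b : Fin p → ℝ) (Φ : Matrix (Fin p) (Fin p) ℝ) : Prop :=
  Φ = Φᵀ ∧ ∀ (b' : Fin p → ℝ) (Φ' : Matrix (Fin p) (Fin p) ℝ), Φ' = Φ'ᵀ →
    typeBObjective X y l₁ l₂ b Φ ≤ typeBObjective X y l₁ l₂ b' Φ'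

/-- The main effects in the original design that correspond to `bˢ`, so that `X b = Xˢ bˢ`. -/
noncomputable def unscaleMain {n p : ℕ} (X : Matrix (Fin n) (Fin p) ℝ) (bs : Fin p → ℝ) :
    Fin p → ℝ :=
  fun j => bs j / l2norm (X.col j)

/-- The interactions in the original design that correspond to `Φˢ`, so that
`X̄ vec(Φ) = X̄ˢ vec(Φˢ)`. -/
noncomputable def unscaleInter {n p : ℕ} (X : Matrix (Fin n) (Fin p) ℝ)
    (Φs : Matrix (Fin p) (Fin p) ℝ) : Matrix (Fin p) (Fin p) ℝ :=
  Matrix.of fun k j => Φs k j / l2norm ((interactions X).col (j, k))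

/-- The restricted eigenvalue condition `A'(Je, JG, ϑ, κ)` on the scaled designs. -/
def REScaled {n p : ℕ} (X : Matrix (Fin n) (Fin p) ℝ) (Se : Finset (Fin p × Fin p))
    (SG : Finset (Fin p)) (ϑ κ : ℝ) : Prop :=
  ∀ (Δb : Fin p → ℝ) (ΔΦ : Matrix (Fin p) (Fin p) ℝ), ΔΦ = ΔΦᵀ →
    ∑ jk ∈ Seᶜ, |ΔΦ.vec jk| + ∑ j ∈ SGᶜ, l2norm ((concat Δb ΔΦ).col j) ≤
      (1 + ϑ) * (∑ jk ∈ Se, |ΔΦ.vec jk| + ∑ j ∈ SG, l2norm ((concat Δb ΔΦ).col j)) →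
    κ * specNorm (fullS X) ^ 2 *
        (∑ jk ∈ Se, ΔΦ.vec jk ^ 2 + ∑ j ∈ SG, l2norm ((concat Δb ΔΦ).col j) ^ 2) ≤
      l2norm (signalS X Δb ΔΦ) ^ 2

end Gresh

namespace Gresh

/-! ### Gaussian exponential moments -/

/-! The proof separates one probabilistic estimate from a deterministic argument. Write τ = log(ep),
K for the spectral norm of the scaled design, and P_S for the projection onto the span of the
columns in S.

Noise: `norm_starProjection_sq_le` gives ‖P_S e‖² ≤ 8σ²τ|S| + R for all S at once, where R =
`noiseRem` sums exponentials over all S. The chi-square exponential moment √2 ^ dim makes E R a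
multiple of (1 + √2 exp(-2τ)) ^ (p + p²), and τ is large enough to give E R ≤ 12σ²
(`lintegral_noiseRem_le`). Since S may depend on e, the random support of the estimate is allowed.

Sparsity: the first order condition is tested in directions that shrink the estimate
(`le_inner_residual`). Its penalty side bounds l₁K·Ĵ_e or l₂K·Ĵ_G from below. The other side is an
inner product of the projected residual with a signal whose coefficients have norm at most a
constant times √Ĵ, hence at most a constant times ‖P r‖·K·√Ĵ. The factor K cancels, and `card_le`
follows: σ²τ(Ĵ_e + Ĵ_G) ≤ (d² + R)/32, with d² the prediction error.

Oracle inequality: quadratic growth of the objective (`objective_add_le`) leaves a spare ½‖s‖²,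
where s is the difference of the fitted signals of the estimate and the reference. Half of it
absorbs the noise term ⟨e, s⟩, half the penalty difference under the restricted eigenvalue
condition. What remains of the noise is 8σ²τ times the two support sizes plus R; `card_le` turns the
estimated one into a fraction of d², which is moved to the left (`oracle_le`). The theorem follows
by rescaling the coefficients and taking expectations. -/

lemma lintegral_exp_linear_pi_gaussianReal {ι : Type*} [Fintype ι] (v : NNReal) (w : ι → ℝ) :
    ∫⁻ x, ENNReal.ofReal (Real.exp (∑ i, w i * x i))
      ∂(Measure.pi fun _ : ι => gaussianReal 0 v) =
    ENNReal.ofReal (Real.exp (v * (∑ i, w i ^ 2) / 2)) := by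
  have hint : Integrable (fun x : ι → ℝ => ∏ i, Real.exp (w i * x i))
      (Measure.pi fun _ : ι => gaussianReal 0 v) :=
    Integrable.fintype_prod (f := fun i x => Real.exp (w i * x))
      fun i => integrable_exp_mul_gaussianReal (w i)
  simp_rw [Real.exp_sum]
  rw [← ofReal_integral_eq_lintegral_ofReal hint
    (Filter.Eventually.of_forall fun x => Finset.prod_nonneg fun i _ => (Real.exp_pos _).le),
    integral_fintype_prod_eq_prod (f := fun i x => Real.exp (w i * x))]
  congr 1
  have h : ∀ i, ∫ x, Real.exp (w i * x) ∂gaussianReal 0 v = Real.exp (v * w i ^ 2 / 2) := by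
    intro i
    have := congrFun (mgf_id_gaussianReal (μ := 0) (v := v)) (w i)
    simpa [mgf] using this
  simp_rw [h]
  rw [← Real.exp_sum, Finset.mul_sum, Finset.sum_div]

/-- The chi-square moment (1 - 2t)^(-1/2) at t = 1/4. -/
lemma integral_exp_sq_gaussianReal :
    ∫ x, Real.exp (x ^ 2 / 4) ∂gaussianReal 0 1 = √2 := by
  rw [integral_gaussianReal_eq_integral_smul one_ne_zero]
  have h : ∀ x : ℝ, gaussianPDFReal 0 1 x • Real.exp (x ^ 2 / 4) =
      (√(2 * Real.pi))⁻¹ * Real.exp (-(1 / 4) * x ^ 2) := by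
    intro x
    simp only [gaussianPDFReal, NNReal.coe_one, mul_one, sub_zero, smul_eq_mul]
    rw [mul_assoc, ← Real.exp_add]
    ring_nf
  simp_rw [h]
  rw [integral_const_mul, integral_gaussian, ← Real.sqrt_inv, ← Real.sqrt_mul (by positivity)]
  congr 1
  have := Real.pi_pos.ne'
  field_simp
  norm_num

lemma lintegral_exp_sum_sq_pi_gaussianReal (ι : Type*) [Fintype ι] :
    ∫⁻ x, ENNReal.ofReal (Real.exp (∑ i, x i ^ 2 / 4))
      ∂(Measure.pi fun _ : ι => gaussianReal 0 1) =
    ENNReal.ofReal (√2 ^ Fintype.card ι) := by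
  have h1 : Integrable (fun x : ℝ => Real.exp (x ^ 2 / 4)) (gaussianReal 0 1) := by
    -- A non-integrable function has integral 0 by convention, but the integral here is √2.
    by_contra h
    have := integral_undef h
    rw [integral_exp_sq_gaussianReal] at this
    simp at this
  have hint : Integrable (fun x : ι → ℝ => ∏ i, Real.exp (x i ^ 2 / 4))
      (Measure.pi fun _ : ι => gaussianReal 0 1) :=
    Integrable.fintype_prod (f := fun _ x => Real.exp (x ^ 2 / 4)) fun _ => h1
  simp_rw [Real.exp_sum]
  rw [← ofReal_integral_eq_lintegral_ofReal hint
    (Filter.Eventually.of_forall fun x => Finset.prod_nonneg fun i _ => (Real.exp_pos _).le),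
    integral_fintype_prod_eq_prod (f := fun _ x => Real.exp (x ^ 2 / 4))]
  simp [integral_exp_sq_gaussianReal]

/-- The squared norms of the coordinates of a Gaussian vector along `d` orthonormal directions
have the exponential moment of a chi-square variable with `d` degrees of freedom. -/
lemma lintegral_exp_sum_sq_inner {n : ℕ} {κ : Type*} [Fintype κ] {σ : ℝ} (hσ : 0 < σ)
    (a : κ → EuclideanSpace ℝ (Fin n)) (ha : Orthonormal ℝ a) :
    ∫⁻ e, ENNReal.ofReal (Real.exp ((∑ k, (inner ℝ (a k) (WithLp.toLp 2 e)) ^ 2) / (4 * σ ^ 2)))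
      ∂(Measure.pi fun _ : Fin n => gaussianReal 0 (Real.toNNReal (σ ^ 2))) =
    ENNReal.ofReal (√2 ^ Fintype.card κ) := by
  set μ := Measure.pi fun _ : Fin n => gaussianReal 0 (Real.toNNReal (σ ^ 2))
  set ν := Measure.pi fun _ : κ => gaussianReal 0 1
  have hs2 : √2 ^ 2 = (2 : ℝ) := Real.sq_sqrt (by norm_num)
  have hs0 : (√2 : ℝ) ≠ 0 := by positivity
  have hinner : ∀ (k : κ) (e : Fin n → ℝ),
      inner ℝ (a k) (WithLp.toLp 2 e) = ∑ i, a k i * e i := by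
    intro k e
    simp [PiLp.inner_apply, mul_comm]
  -- Gaussian linearization: exp(s²/(4σ²)) is the mean of exp(s g/(√2 σ)) over a standard normal g.
  -- After exchanging the integrals the exponent is linear in e, and orthonormality reduces its
  -- moment to exp(‖g‖²/4); rotation invariance is not needed.
  have hA : ∀ e : Fin n → ℝ,
      ENNReal.ofReal (Real.exp ((∑ k, (inner ℝ (a k) (WithLp.toLp 2 e)) ^ 2) / (4 * σ ^ 2))) =
      ∫⁻ g, ENNReal.ofReal (Real.exp (∑ k, (∑ i, a k i * e i) / (√2 * σ) * g k)) ∂ν := by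
    intro e
    rw [lintegral_exp_linear_pi_gaussianReal]
    congr 2
    simp_rw [hinner, div_pow, mul_pow, hs2]
    rw [← Finset.sum_div]
    simp only [NNReal.coe_one, one_mul]
    field_simp
    norm_num
  simp_rw [hA]
  rw [lintegral_lintegral_swap (by
    apply Measurable.aemeasurable
    fun_prop)]
  have hB : ∀ g : κ → ℝ,
      ∫⁻ e, ENNReal.ofReal (Real.exp (∑ k, (∑ i, a k i * e i) / (√2 * σ) * g k)) ∂μ =
      ENNReal.ofReal (Real.exp (∑ k, g k ^ 2 / 4)) := by
    intro g
    have h1 : ∀ e : Fin n → ℝ, ∑ k, (∑ i, a k i * e i) / (√2 * σ) * g k =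
        ∑ i, (∑ k, g k * a k i) / (√2 * σ) * e i := by
      intro e
      simp_rw [Finset.sum_div, Finset.sum_mul]
      rw [Finset.sum_comm]
      refine Finset.sum_congr rfl fun i _ => Finset.sum_congr rfl fun k _ => ?_
      ring
    simp_rw [h1]
    rw [lintegral_exp_linear_pi_gaussianReal]
    congr 2
    have h2 : ∑ i, (∑ k, g k * a k i) ^ 2 = ∑ k, g k ^ 2 := by
      have h3 := ha.inner_sum g g Finset.univ
      have h4 : inner ℝ (∑ k, g k • a k) (∑ k, g k • a k) = ∑ i, (∑ k, g k * a k i) ^ 2 := by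
        rw [PiLp.inner_apply]
        refine Finset.sum_congr rfl fun i _ => ?_
        simp [pow_two]
      rw [← h4, h3]
      simp [pow_two]
    simp_rw [div_pow, mul_pow, hs2]
    rw [← Finset.sum_div, h2, Real.coe_toNNReal _ (by positivity), ← Finset.sum_div]
    field_simp
    norm_num
  simp_rw [hB]
  exact lintegral_exp_sum_sq_pi_gaussianReal κ

lemma lintegral_exp_norm_starProjection {n : ℕ} {σ : ℝ} (hσ : 0 < σ)
    (V : Submodule ℝ (EuclideanSpace ℝ (Fin n))) :
    ∫⁻ e, ENNReal.ofReal (Real.exp (‖V.starProjection (WithLp.toLp 2 e)‖ ^ 2 / (4 * σ ^ 2)))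
      ∂(Measure.pi fun _ : Fin n => gaussianReal 0 (Real.toNNReal (σ ^ 2))) =
    ENNReal.ofReal (√2 ^ Module.finrank ℝ V) := by
  have ho := (stdOrthonormalBasis ℝ V).orthonormal.comp_linearIsometry V.subtypeₗᵢ
  have h := lintegral_exp_sum_sq_inner hσ _ ho
  rw [Fintype.card_fin] at h
  rw [← h]
  refine lintegral_congr fun e => ?_
  congr 3
  have h1 := (stdOrthonormalBasis ℝ V).sum_sq_norm_inner_right
    (V.orthogonalProjectionOnto (WithLp.toLp 2 e))
  rw [Submodule.starProjection_apply, ← Submodule.coe_norm, ← h1]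
  refine Finset.sum_congr rfl fun k _ => ?_
  rw [Submodule.inner_orthogonalProjectionOnto_eq_of_mem_left, Real.norm_eq_abs, sq_abs]
  rfl

/-! ### Uniform control of the projected noise -/

/-- The span of the columns of `Z` with index in `S`. -/
noncomputable def colSpan {n : ℕ} {ι : Type*} (Z : Matrix (Fin n) ι ℝ) (S : Finset ι) :
    Submodule ℝ (EuclideanSpace ℝ (Fin n)) :=
  Submodule.span ℝ ((fun j => WithLp.toLp 2 (Z.col j)) '' (S : Set ι))

lemma finrank_colSpan_le {n : ℕ} {ι : Type*} (Z : Matrix (Fin n) ι ℝ) (S : Finset ι) :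
    Module.finrank ℝ (colSpan Z S) ≤ S.card := by
  classical
  rw [colSpan, ← Finset.coe_image]
  exact (finrank_span_finset_le_card _).trans Finset.card_image_le

/-- The random remainder in the uniform bound of the projected noise. -/
noncomputable def noiseRem {n : ℕ} {ι : Type*} [Fintype ι] (Z : Matrix (Fin n) ι ℝ) (σ τ : ℝ)
    (e : Fin n → ℝ) : ℝ :=
  ∑ S : Finset ι, 4 * σ ^ 2 * Real.exp (-(2 * τ)) ^ S.card *
    Real.exp (‖(colSpan Z S).starProjection (WithLp.toLp 2 e)‖ ^ 2 / (4 * σ ^ 2))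

lemma noiseRem_nonneg {n : ℕ} {ι : Type*} [Fintype ι] (Z : Matrix (Fin n) ι ℝ) (σ τ : ℝ)
    (e : Fin n → ℝ) : 0 ≤ noiseRem Z σ τ e :=
  Finset.sum_nonneg fun _ _ => by positivity

lemma continuous_noiseRem {n : ℕ} {ι : Type*} [Fintype ι] (Z : Matrix (Fin n) ι ℝ) (σ τ : ℝ) :
    Continuous (noiseRem Z σ τ) := by
  unfold noiseRem
  fun_prop

/-- A single summand of the nonnegative sum `noiseRem` already suffices, by x ≤ exp x with x = ‖P_S
e‖²/(4σ²) - 2τ|S|. -/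
lemma norm_starProjection_sq_le {n : ℕ} {ι : Type*} [Fintype ι] (Z : Matrix (Fin n) ι ℝ)
    {σ : ℝ} (hσ : 0 < σ) (τ : ℝ) (e : Fin n → ℝ) (S : Finset ι) :
    ‖(colSpan Z S).starProjection (WithLp.toLp 2 e)‖ ^ 2 ≤
      8 * σ ^ 2 * τ * S.card + noiseRem Z σ τ e := by
  set N := ‖(colSpan Z S).starProjection (WithLp.toLp 2 e)‖ ^ 2 with hN
  have h1 : 4 * σ ^ 2 * Real.exp (-(2 * τ)) ^ S.card * Real.exp (N / (4 * σ ^ 2)) ≤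
      noiseRem Z σ τ e :=
    Finset.single_le_sum (f := fun S : Finset ι => 4 * σ ^ 2 * Real.exp (-(2 * τ)) ^ S.card *
      Real.exp (‖(colSpan Z S).starProjection (WithLp.toLp 2 e)‖ ^ 2 / (4 * σ ^ 2)))
      (fun _ _ => by positivity) (Finset.mem_univ S)
  rw [mul_assoc, ← Real.exp_nat_mul, ← Real.exp_add] at h1
  have h2 := Real.add_one_le_exp ((S.card : ℝ) * -(2 * τ) + N / (4 * σ ^ 2))
  have h3 : 4 * σ ^ 2 * ((S.card : ℝ) * -(2 * τ) + N / (4 * σ ^ 2)) ≤ noiseRem Z σ τ e := by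
    refine le_trans ?_ h1
    gcongr
    linarith
  have h4 : 4 * σ ^ 2 * ((S.card : ℝ) * -(2 * τ) + N / (4 * σ ^ 2)) =
      N - 8 * σ ^ 2 * τ * S.card := by
    field_simp
    ring
  linarith

lemma lintegral_noiseRem_le {n : ℕ} {ι : Type*} [Fintype ι] (Z : Matrix (Fin n) ι ℝ)
    {σ : ℝ} (hσ : 0 < σ) (τ : ℝ) (hτ : Fintype.card ι * (√2 * Real.exp (-(2 * τ))) ≤ 1) :
    ∫⁻ e, ENNReal.ofReal (noiseRem Z σ τ e)
      ∂(Measure.pi fun _ : Fin n => gaussianReal 0 (Real.toNNReal (σ ^ 2))) ≤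
    ENNReal.ofReal (12 * σ ^ 2) := by
  set x := Real.exp (-(2 * τ)) with hx
  have hx0 : 0 < x := Real.exp_pos _
  have h1 : ∀ e, ENNReal.ofReal (noiseRem Z σ τ e) =
      ∑ S : Finset ι, ENNReal.ofReal (4 * σ ^ 2 * x ^ S.card) * ENNReal.ofReal
        (Real.exp (‖(colSpan Z S).starProjection (WithLp.toLp 2 e)‖ ^ 2 / (4 * σ ^ 2))) := by
    intro e
    rw [noiseRem, ENNReal.ofReal_sum_of_nonneg fun _ _ => by positivity]
    exact Finset.sum_congr rfl fun S _ => ENNReal.ofReal_mul (by positivity)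
  simp_rw [h1]
  rw [lintegral_finsetSum _ fun S _ => by fun_prop]
  have h2 : ∀ S : Finset ι, ∫⁻ e, ENNReal.ofReal (4 * σ ^ 2 * x ^ S.card) * ENNReal.ofReal
        (Real.exp (‖(colSpan Z S).starProjection (WithLp.toLp 2 e)‖ ^ 2 / (4 * σ ^ 2)))
        ∂(Measure.pi fun _ : Fin n => gaussianReal 0 (Real.toNNReal (σ ^ 2))) ≤
      ENNReal.ofReal (4 * σ ^ 2 * (√2 * x) ^ S.card) := by
    intro S
    rw [lintegral_const_mul _ (by fun_prop), lintegral_exp_norm_starProjection hσ,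
      ← ENNReal.ofReal_mul (by positivity)]
    refine ENNReal.ofReal_le_ofReal ?_
    rw [mul_pow, mul_assoc, mul_comm (√2 ^ _)]
    gcongr
    -- The columns in S may be dependent; as √2 ≥ 1, the rank can be replaced by |S|.
    · exact Real.one_le_sqrt.2 (by norm_num)
    · exact finrank_colSpan_le Z S
  refine (Finset.sum_le_sum fun S _ => h2 S).trans ?_
  rw [← ENNReal.ofReal_sum_of_nonneg fun _ _ => by positivity]
  refine ENNReal.ofReal_le_ofReal ?_
  rw [← Finset.mul_sum]
  -- The sum of x^|S| over all subsets S is (1 + x)^card, here at most e; finally 4e ≤ 12.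
  have h3 := Fintype.sum_pow_mul_eq_add_pow ι (√2 * x) 1
  simp only [one_pow, mul_one] at h3
  rw [h3]
  have h4 : (√2 * x + 1) ^ Fintype.card ι ≤ Real.exp 1 := by
    calc (√2 * x + 1) ^ Fintype.card ι ≤ Real.exp (√2 * x) ^ Fintype.card ι := by
          gcongr
          exact Real.add_one_le_exp _
      _ = Real.exp (Fintype.card ι * (√2 * x)) := (Real.exp_nat_mul _ _).symm
      _ ≤ Real.exp 1 := Real.exp_le_exp.2 hτ
  have := Real.exp_one_lt_d9
  nlinarith [sq_nonneg σ]

/-- There are p + p² ≤ 2p² predictors and exp(-2τ) = (ep)⁻², so the claim reduces to 2√2 ≤ 3 ≤ e².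
-/
lemma card_mul_exp_log_le_one {p : ℕ} (hp : 1 ≤ p) :
    (Fintype.card (Fin p ⊕ Fin p × Fin p) : ℝ) *
      (√2 * Real.exp (-(2 * Real.log (Real.exp 1 * p)))) ≤ 1 := by
  have hp' : (1 : ℝ) ≤ p := by exact_mod_cast hp
  have he := Real.exp_one_gt_d9
  have h2 : √2 ≤ 3 / 2 := by
    rw [Real.sqrt_le_left (by norm_num)]; norm_num
  have h1 : Real.exp (-(2 * Real.log (Real.exp 1 * p))) = ((Real.exp 1 * p) ^ 2)⁻¹ := by
    rw [Real.exp_neg, ← Real.exp_log (x := Real.exp 1 * p) (by positivity), ← Real.exp_nat_mul]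
    simp
  rw [h1]
  simp only [Fintype.card_sum, Fintype.card_prod, Fintype.card_fin, Nat.cast_add, Nat.cast_mul]
  rw [← mul_assoc, ← div_eq_mul_inv, div_le_one (by positivity)]
  have h3 : (p + p * p : ℝ) ≤ 2 * p ^ 2 := by nlinarith
  calc (p + p * p : ℝ) * √2 ≤ 2 * p ^ 2 * (3 / 2) := by gcongr
    _ ≤ (Real.exp 1 * p) ^ 2 := by
          rw [mul_pow]
          have : (3 : ℝ) ≤ Real.exp 1 ^ 2 := by nlinarith
          nlinarith [sq_nonneg (p : ℝ)]

/-! ### Elementary facts on norms, signals and supports -/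

section Basics

variable {ι : Type*} [Fintype ι]

lemma l2norm_nonneg (v : ι → ℝ) : 0 ≤ l2norm v := norm_nonneg _

lemma l2norm_sq (v : ι → ℝ) : l2norm v ^ 2 = ∑ i, v i ^ 2 := by
  simp [l2norm, EuclideanSpace.norm_sq_eq]

lemma l2norm_add_le (v w : ι → ℝ) : l2norm (v + w) ≤ l2norm v + l2norm w := by
  simpa [l2norm, WithLp.toLp_add] using
    norm_add_le (WithLp.toLp 2 v : EuclideanSpace ℝ ι) (WithLp.toLp 2 w)

lemma l2norm_smul (c : ℝ) (v : ι → ℝ) : l2norm (c • v) = |c| * l2norm v := by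
  simp [l2norm, WithLp.toLp_smul, norm_smul]

lemma l2norm_neg (v : ι → ℝ) : l2norm (-v) = l2norm v := by
  simp [l2norm, WithLp.toLp_neg]

lemma l2norm_eq_zero {v : ι → ℝ} : l2norm v = 0 ↔ v = 0 := by
  simp [l2norm]

lemma continuous_l2norm : Continuous (l2norm : (ι → ℝ) → ℝ) := by
  unfold l2norm
  fun_prop

end Basics

variable {n p : ℕ}

lemma col_concat_apply_inl (b : Fin p → ℝ) (Φ : Matrix (Fin p) (Fin p) ℝ) (j : Fin p) (i : Unit) :
    (concat b Φ).col j (Sum.inl i) = b j := rfl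

lemma col_concat_apply_inr (b : Fin p → ℝ) (Φ : Matrix (Fin p) (Fin p) ℝ) (j k : Fin p) :
    (concat b Φ).col j (Sum.inr k) = Φ k j := rfl

lemma l2norm_col_concat_sq (b : Fin p → ℝ) (Φ : Matrix (Fin p) (Fin p) ℝ) (j : Fin p) :
    l2norm ((concat b Φ).col j) ^ 2 = b j ^ 2 + ∑ k, Φ k j ^ 2 := by
  rw [l2norm_sq, Fintype.sum_sum_type]
  simp only [col_concat_apply_inl, col_concat_apply_inr, Finset.univ_unique, Finset.sum_singleton]

lemma col_concat_add (b b' : Fin p → ℝ) (Φ Φ' : Matrix (Fin p) (Fin p) ℝ) (j : Fin p) :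
    (concat (b + b') (Φ + Φ')).col j = (concat b Φ).col j + (concat b' Φ').col j := by
  ext (i | k) <;> rfl

lemma col_concat_smul (c : ℝ) (b : Fin p → ℝ) (Φ : Matrix (Fin p) (Fin p) ℝ) (j : Fin p) :
    (concat (c • b) (c • Φ)).col j = c • (concat b Φ).col j := by
  ext (i | k) <;> rfl

lemma sum_vec {M : Type*} [AddCommMonoid M] (f : ℝ → M) (Φ : Matrix (Fin p) (Fin p) ℝ) :
    ∑ jk, f (Φ.vec jk) = ∑ j, ∑ k, f (Φ k j) := by
  rw [Fintype.sum_prod_type]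
  rfl

lemma mem_Je {Φ : Matrix (Fin p) (Fin p) ℝ} {jk : Fin p × Fin p} :
    jk ∈ Je Φ ↔ Φ.vec jk ≠ 0 :=
  Finset.mem_filter.trans (and_iff_right (Finset.mem_univ _))

lemma mem_JG {b : Fin p → ℝ} {Φ : Matrix (Fin p) (Fin p) ℝ} {j : Fin p} :
    j ∈ JG b Φ ↔ l2norm ((concat b Φ).col j) ≠ 0 := by
  rw [← pow_ne_zero_iff (n := 2) two_ne_zero, l2norm_col_concat_sq]
  simp [JG, l2norm_sq, Matrix.col_apply]

lemma ne_zero_mem_JG {b : Fin p → ℝ} {Φ : Matrix (Fin p) (Fin p) ℝ} {j : Fin p} (h : b j ≠ 0) :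
    j ∈ JG b Φ := by
  rw [mem_JG, ← pow_ne_zero_iff (n := 2) two_ne_zero, l2norm_col_concat_sq]
  have : 0 < b j ^ 2 := by positivity
  have : 0 ≤ ∑ k, Φ k j ^ 2 := Finset.sum_nonneg fun _ _ => sq_nonneg _
  linarith

/-- The predictors that are selected by `(b, Φ)`. -/
noncomputable def predSupp (b : Fin p → ℝ) (Φ : Matrix (Fin p) (Fin p) ℝ) :
    Finset (Fin p ⊕ Fin p × Fin p) :=
  (Finset.univ.filter fun j => b j ≠ 0).disjSum (Je Φ)

lemma card_predSupp_le (b : Fin p → ℝ) (Φ : Matrix (Fin p) (Fin p) ℝ) :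
    ((predSupp b Φ).card : ℝ) ≤ (Je Φ).card + (JG b Φ).card := by
  rw [predSupp, Finset.card_disjSum]
  have : (Finset.univ.filter fun j => b j ≠ 0).card ≤ (JG b Φ).card :=
    Finset.card_le_card fun j hj => ne_zero_mem_JG (by simpa using hj)
  have h : (((Finset.univ.filter fun j => b j ≠ 0).card : ℕ) : ℝ) ≤ (JG b Φ).card := by
    exact_mod_cast this
  push_cast
  linarith

lemma signalS_eq (X : Matrix (Fin n) (Fin p) ℝ) (b : Fin p → ℝ) (Φ : Matrix (Fin p) (Fin p) ℝ) :
    signalS X b Φ = fullS X *ᵥ Sum.elim b Φ.vec := by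
  rw [fullS, Matrix.fromCols_mulVec_sumElim, signalS]

lemma signalS_add (X : Matrix (Fin n) (Fin p) ℝ) (b b' : Fin p → ℝ)
    (Φ Φ' : Matrix (Fin p) (Fin p) ℝ) :
    signalS X (b + b') (Φ + Φ') = signalS X b Φ + signalS X b' Φ' := by
  simp only [signalS, Matrix.vec_add, Matrix.mulVec_add]
  abel

lemma signalS_smul (X : Matrix (Fin n) (Fin p) ℝ) (c : ℝ) (b : Fin p → ℝ)
    (Φ : Matrix (Fin p) (Fin p) ℝ) :
    signalS X (c • b) (c • Φ) = c • signalS X b Φ := by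
  simp only [signalS, Matrix.vec_smul, Matrix.mulVec_smul, smul_add]

lemma signalS_sub (X : Matrix (Fin n) (Fin p) ℝ) (b b' : Fin p → ℝ)
    (Φ Φ' : Matrix (Fin p) (Fin p) ℝ) :
    signalS X (b - b') (Φ - Φ') = signalS X b Φ - signalS X b' Φ' := by
  simp only [signalS, Matrix.vec_sub, Matrix.mulVec_sub]
  abel

lemma l2norm_mulVec_le {ι : Type*} [Fintype ι] [DecidableEq ι] (Z : Matrix (Fin n) ι ℝ)
    (v : ι → ℝ) : l2norm (Z *ᵥ v) ≤ specNorm Z * l2norm v :=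
  Matrix.l2_opNorm_mulVec Z (WithLp.toLp 2 v)

open scoped Matrix.Norms.L2Operator in
lemma specNorm_nonneg {ι : Type*} [Fintype ι] [DecidableEq ι] (Z : Matrix (Fin n) ι ℝ) :
    0 ≤ specNorm Z :=
  norm_nonneg Z

open scoped Matrix.Norms.L2Operator in
lemma eq_zero_of_specNorm_eq_zero {ι : Type*} [Fintype ι] [DecidableEq ι]
    {Z : Matrix (Fin n) ι ℝ} (h : specNorm Z = 0) : Z = 0 :=
  norm_eq_zero.1 h

/-- Positivity is what allows K to be cancelled in the sparsity bounds; p ≥ 1 provides a nonzero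
column. -/
lemma specNorm_fullS_pos {X : Matrix (Fin n) (Fin p) ℝ} (hp : 1 ≤ p) (hX : ∀ j, X.col j ≠ 0) :
    0 < specNorm (fullS X) := by
  refine lt_of_le_of_ne (specNorm_nonneg _) fun h => ?_
  have h1 : fullS X = 0 := eq_zero_of_specNorm_eq_zero h.symm
  let j : Fin p := ⟨0, hp⟩
  refine hX j ?_
  ext i
  have h2 := congrFun (congrFun h1 i) (Sum.inl j)
  change X i j / l2norm (X.col j) = 0 at h2
  rcases div_eq_zero_iff.1 h2 with h3 | h3
  · exact h3
  · exact absurd (l2norm_eq_zero.1 h3) (hX j)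

lemma toLp_mulVec_mem_colSpan {ι : Type*} [Fintype ι] (Z : Matrix (Fin n) ι ℝ) (S : Finset ι)
    (v : ι → ℝ) (hv : ∀ i, i ∉ S → v i = 0) : WithLp.toLp 2 (Z *ᵥ v) ∈ colSpan Z S := by
  have h : WithLp.toLp 2 (Z *ᵥ v) = ∑ i, v i • (WithLp.toLp 2 (Z.col i) : EuclideanSpace ℝ _) := by
    ext k
    simp [Matrix.mulVec, dotProduct, mul_comm]
  rw [h]
  refine Submodule.sum_mem _ fun i _ => ?_
  by_cases hi : i ∈ S
  · exact Submodule.smul_mem _ _ (Submodule.subset_span ⟨i, hi, rfl⟩)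
  · simp [hv i hi]

/-- The coefficients `b'`, `Φ'` are either those of the estimate or reference itself, or their
entrywise multiples used as test directions. -/
lemma toLp_signalS_mem_colSpan (X : Matrix (Fin n) (Fin p) ℝ)
    (S : Finset (Fin p ⊕ Fin p × Fin p)) {b b' : Fin p → ℝ} {Φ Φ' : Matrix (Fin p) (Fin p) ℝ}
    (hS : predSupp b Φ ⊆ S) (hb : ∀ j, b j = 0 → b' j = 0)
    (hΦ : ∀ k j, Φ k j = 0 → Φ' k j = 0) :
    WithLp.toLp 2 (signalS X b' Φ') ∈ colSpan (fullS X) S := by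
  rw [signalS_eq]
  refine toLp_mulVec_mem_colSpan _ _ _ ?_
  rintro (j | jk) hj
  · refine hb j ?_
    by_contra h
    exact hj (hS (by simp [predSupp, h]))
  · refine hΦ jk.2 jk.1 ?_
    by_contra h
    exact hj (hS (by simpa [predSupp, mem_Je] using h))

lemma inner_le_norm_starProjection_mul {E : Type*} [NormedAddCommGroup E] [InnerProductSpace ℝ E]
    (V : Submodule ℝ E) [V.HasOrthogonalProjection] (e : E) {v : E} (hv : v ∈ V) :
    inner ℝ e v ≤ ‖V.starProjection e‖ * ‖v‖ := by
  have h : inner ℝ (V.starProjection e) v = inner ℝ e v := by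
    rw [Submodule.inner_starProjection_left_eq_right, Submodule.starProjection_eq_self_iff.2 hv]
  rw [← h]
  exact real_inner_le_norm _ _

/-- Division by t and t → 0, in a form that replaces directional derivatives of the nonsmooth
objective. -/
lemma nonneg_of_forall_small_quadratic {α β s : ℝ} (hs : 0 < s)
    (h : ∀ t, 0 < t → t ≤ s → 0 ≤ t * α + t ^ 2 * β) : 0 ≤ α := by
  by_contra! hα
  have hβ : 0 < |β| + 1 := by positivity
  set t := min s (-α / (2 * (|β| + 1))) with ht
  have hq : 0 < -α / (2 * (|β| + 1)) := div_pos (by linarith) (by positivity)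
  have ht0 : 0 < t := lt_min hs hq
  have h1 := h t ht0 (min_le_left _ _)
  have h2 : t * (2 * (|β| + 1)) ≤ -α := (le_div_iff₀ (by positivity)).1 (min_le_right _ _)
  have h3 : 0 ≤ α + t * β := by
    by_contra! h4
    nlinarith
  have h4 : t * β ≤ t * |β| := by gcongr; exact le_abs_self β
  nlinarith

/-! ### Optimality conditions -/

lemma l2norm_add_smul_sq {ι : Type*} [Fintype ι] (a s : ι → ℝ) (t : ℝ) :
    l2norm (a + t • s) ^ 2 = l2norm a ^ 2 +
      2 * t * inner ℝ (WithLp.toLp 2 a) (WithLp.toLp 2 s) + t ^ 2 * l2norm s ^ 2 := by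
  unfold l2norm
  rw [WithLp.toLp_add, WithLp.toLp_smul, norm_add_sq_real, inner_smul_right, norm_smul, mul_pow,
    Real.norm_eq_abs, sq_abs]
  ring

lemma penalty_convex_le {l₁ l₂ : ℝ} (h₁ : 0 ≤ l₁) (h₂ : 0 ≤ l₂) {t : ℝ} (ht0 : 0 ≤ t)
    (ht1 : t ≤ 1) (b b' : Fin p → ℝ) (Φ Φ' : Matrix (Fin p) (Fin p) ℝ) :
    penalty l₁ l₂ ((1 - t) • b + t • b') ((1 - t) • Φ + t • Φ') ≤
      (1 - t) * penalty l₁ l₂ b Φ + t * penalty l₁ l₂ b' Φ' := by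
  have ht : 0 ≤ 1 - t := by linarith
  have h1 : ∑ jk, |((1 - t) • Φ + t • Φ').vec jk| ≤
      (1 - t) * ∑ jk, |Φ.vec jk| + t * ∑ jk, |Φ'.vec jk| := by
    rw [Finset.mul_sum, Finset.mul_sum, ← Finset.sum_add_distrib]
    refine Finset.sum_le_sum fun jk _ => ?_
    have := abs_add_le ((1 - t) * Φ.vec jk) (t * Φ'.vec jk)
    rwa [abs_mul, abs_mul, abs_of_nonneg ht, abs_of_nonneg ht0] at this
  have h2 : ∑ j, l2norm ((concat ((1 - t) • b + t • b') ((1 - t) • Φ + t • Φ')).col j) ≤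
      (1 - t) * ∑ j, l2norm ((concat b Φ).col j) + t * ∑ j, l2norm ((concat b' Φ').col j) := by
    rw [Finset.mul_sum, Finset.mul_sum, ← Finset.sum_add_distrib]
    refine Finset.sum_le_sum fun j _ => ?_
    rw [col_concat_add, col_concat_smul, col_concat_smul]
    refine (l2norm_add_le _ _).trans ?_
    rw [l2norm_smul, l2norm_smul, abs_of_nonneg ht, abs_of_nonneg ht0]
  unfold penalty
  have := mul_le_mul_of_nonneg_left h1 h₁
  have := mul_le_mul_of_nonneg_left h2 h₂
  linarith

/-- The objective grows quadratically away from a minimizer. -/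
lemma IsTypeBMinimizer.objective_add_le {X : Matrix (Fin n) (Fin p) ℝ} {y : Fin n → ℝ}
    {l₁ l₂ : ℝ} {bh : Fin p → ℝ} {Φh : Matrix (Fin p) (Fin p) ℝ}
    (h : IsTypeBMinimizer X y l₁ l₂ bh Φh) (h₁ : 0 ≤ l₁) (h₂ : 0 ≤ l₂)
    (b : Fin p → ℝ) (Φ : Matrix (Fin p) (Fin p) ℝ) (hΦ : Φ = Φᵀ) :
    typeBObjective X y l₁ l₂ bh Φh + 1 / 2 * l2norm (signalS X (bh - b) (Φh - Φ)) ^ 2 ≤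
      typeBObjective X y l₁ l₂ b Φ := by
  set K := specNorm (fullS X)
  have hK : 0 ≤ K := specNorm_nonneg _
  set s := signalS X (bh - b) (Φh - Φ) with hs
  set r := y - signalS X bh Φh with hr
  have hb : y - signalS X b Φ = r + (1 : ℝ) • s := by
    rw [hs, signalS_sub, hr, one_smul]; abel
  rw [← sub_nonneg]
  -- Minimality is tested along the segment from the estimate to the reference. The first order term
  -- alone is nonnegative, so the full quadratic term ½‖s‖² of the loss remains as a gain.
  refine nonneg_of_forall_small_quadratic (β := 1 / 2 * l2norm s ^ 2) one_pos fun t ht0 ht1 => ?_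
  have hmin := h.2 ((1 - t) • bh + t • b) ((1 - t) • Φh + t • Φ) (by
    rw [Matrix.transpose_add, Matrix.transpose_smul, Matrix.transpose_smul, ← h.1, ← hΦ])
  have hbt : y - signalS X ((1 - t) • bh + t • b) ((1 - t) • Φh + t • Φ) = r + t • s := by
    rw [signalS_add, signalS_smul, signalS_smul, hs, signalS_sub, hr, sub_smul, one_smul, smul_sub]
    abel
  have hpen := penalty_convex_le (mul_nonneg h₁ hK) (mul_nonneg h₂ hK) ht0.le ht1 bh b Φh Φ
  unfold typeBObjective at hmin ⊢
  rw [hbt, l2norm_add_smul_sq] at hmin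
  rw [hb, l2norm_add_smul_sq]
  nlinarith

/-- With g, g' the norms before and after, this is g' ≤ (g² + g'²)/(2g) expanded in t. For v = 0 the
quotients are 0 by convention. -/
lemma l2norm_shrink_le {ι : Type*} [Fintype ι] (v w : ι → ℝ) (t : ℝ) :
    l2norm (fun i => v i - t * (w i * v i)) ≤
      l2norm v - t * ((∑ i, w i * v i ^ 2) / l2norm v) +
        t ^ 2 * ((∑ i, (w i * v i) ^ 2) / (2 * l2norm v)) := by
  rcases (l2norm_nonneg v).eq_or_lt with h0 | h0
  · have hv : v = 0 := l2norm_eq_zero.1 h0.symm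
    have h1 : l2norm (fun _ : ι => (0 : ℝ)) = 0 := l2norm_eq_zero.2 rfl
    simp [hv, h1, l2norm_nonneg]
  · set g := l2norm v with hg
    set g' := l2norm (fun i => v i - t * (w i * v i)) with hg'
    have h1 : g' ^ 2 = g ^ 2 - 2 * t * (∑ i, w i * v i ^ 2) + t ^ 2 * ∑ i, (w i * v i) ^ 2 := by
      rw [hg', hg, l2norm_sq, l2norm_sq, Finset.mul_sum, Finset.mul_sum, ← Finset.sum_sub_distrib,
        ← Finset.sum_add_distrib]
      refine Finset.sum_congr rfl fun i _ => ?_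
      ring
    have h2 : g - t * ((∑ i, w i * v i ^ 2) / g) + t ^ 2 * ((∑ i, (w i * v i) ^ 2) / (2 * g)) =
        (g ^ 2 + g' ^ 2) / (2 * g) := by
      rw [h1]
      field_simp
      ring
    rw [h2, le_div_iff₀ (by positivity)]
    nlinarith [sq_nonneg (g - g')]

/-- The first order condition of a minimizer in the directions that shrink its coefficients. -/
lemma IsTypeBMinimizer.le_inner_residual {X : Matrix (Fin n) (Fin p) ℝ} {y : Fin n → ℝ}
    {l₁ l₂ : ℝ} {bh : Fin p → ℝ} {Φh : Matrix (Fin p) (Fin p) ℝ}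
    (h : IsTypeBMinimizer X y l₁ l₂ bh Φh) (h₂ : 0 ≤ l₂)
    (u : Fin p → ℝ) (W : Matrix (Fin p) (Fin p) ℝ) (hW0 : ∀ k j, 0 ≤ W k j)
    (hW : ∀ k j, W k j = W j k) :
    l₁ * specNorm (fullS X) * (∑ j, ∑ k, W k j * |Φh k j|) + l₂ * specNorm (fullS X) *
        ∑ j, (u j * bh j ^ 2 + ∑ k, W k j * Φh k j ^ 2) / l2norm ((concat bh Φh).col j) ≤
      inner ℝ (WithLp.toLp 2 (y - signalS X bh Φh))
        (WithLp.toLp 2 (signalS X (fun j => u j * bh j) (Matrix.of fun k j => W k j * Φh k j))) := by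
  set K := specNorm (fullS X)
  have hK : 0 ≤ K := specNorm_nonneg _
  set db : Fin p → ℝ := fun j => u j * bh j with hdb
  set dΦ : Matrix (Fin p) (Fin p) ℝ := Matrix.of fun k j => W k j * Φh k j with hdΦ
  set s := signalS X db dΦ with hs
  set r := y - signalS X bh Φh with hr
  set g : Fin p → ℝ := fun j => l2norm ((concat bh Φh).col j)
  set q : Fin p → ℝ := fun j => ((u j * bh j) ^ 2 + ∑ k, (W k j * Φh k j) ^ 2) / (2 * g j) with hq
  have hdΦs : dΦ = dΦᵀ := by
    ext k j
    have : Φh k j = Φh j k := congrFun (congrFun h.1 k) j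
    simp [hdΦ, hW k j, this]
  set w := ∑ j, ∑ k, W k j with hw
  have hw0 : 0 ≤ w := Finset.sum_nonneg fun j _ => Finset.sum_nonneg fun k _ => hW0 k j
  have hWw : ∀ k j, W k j ≤ w := fun k j =>
    (Finset.single_le_sum (f := fun k => W k j) (fun k _ => hW0 k j) (Finset.mem_univ k)).trans
      (Finset.single_le_sum (f := fun j => ∑ k, W k j)
        (fun j _ => Finset.sum_nonneg fun k _ => hW0 k j) (Finset.mem_univ j))
  rw [← sub_nonneg]
  -- The total weight w dominates each entry of W, so t ≤ 1/(w + 1) keeps 1 - tW ≥ 0: no entry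
  -- changes sign and the ℓ₁ norm is exactly linear in t.
  refine nonneg_of_forall_small_quadratic (β := 1 / 2 * l2norm s ^ 2 + l₂ * K * ∑ j, q j)
    (s := 1 / (w + 1)) (by positivity) fun t ht0 ht1 => ?_
  have htw : t * (w + 1) ≤ 1 := (le_div_iff₀ (by positivity)).1 ht1
  have hmin := h.2 (bh + (-t) • db) (Φh + (-t) • dΦ) (by
    rw [Matrix.transpose_add, Matrix.transpose_smul, ← h.1, ← hdΦs])
  have hres : y - signalS X (bh + (-t) • db) (Φh + (-t) • dΦ) = r + t • s := by
    rw [signalS_add, signalS_smul, hr, neg_smul]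
    abel
  have hl1 : ∑ jk, |(Φh + (-t) • dΦ).vec jk| =
      ∑ jk, |Φh.vec jk| - t * ∑ j, ∑ k, W k j * |Φh k j| := by
    rw [sum_vec (fun x => |x|), sum_vec (fun x => |x|), Finset.mul_sum, ← Finset.sum_sub_distrib]
    refine Finset.sum_congr rfl fun j _ => ?_
    rw [Finset.mul_sum, ← Finset.sum_sub_distrib]
    refine Finset.sum_congr rfl fun k _ => ?_
    have h1 : (Φh + (-t) • dΦ) k j = (1 - t * W k j) * Φh k j := by
      simp [hdΦ]; ring
    have h2 : t * W k j ≤ 1 := by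
      have := mul_le_mul_of_nonneg_left (hWw k j) ht0.le
      linarith
    rw [h1, abs_mul, abs_of_nonneg (by linarith)]
    ring
  have hgr : ∑ j, l2norm ((concat (bh + (-t) • db) (Φh + (-t) • dΦ)).col j) ≤
      ∑ j, g j - t * ∑ j, (u j * bh j ^ 2 + ∑ k, W k j * Φh k j ^ 2) / g j + t ^ 2 * ∑ j, q j := by
    rw [Finset.mul_sum, Finset.mul_sum, ← Finset.sum_sub_distrib, ← Finset.sum_add_distrib]
    refine Finset.sum_le_sum fun j _ => ?_
    have h1 := l2norm_shrink_le ((concat bh Φh).col j) (Sum.elim (fun _ => u j) fun k => W k j) t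
    have h2 : (concat (bh + (-t) • db) (Φh + (-t) • dΦ)).col j = fun i =>
        (concat bh Φh).col j i -
          t * ((Sum.elim (fun _ => u j) fun k => W k j : Unit ⊕ Fin p → ℝ) i *
            (concat bh Φh).col j i) := by
      ext (i | k)
      · simp only [col_concat_apply_inl, Sum.elim_inl, hdb, Pi.add_apply, Pi.smul_apply,
          smul_eq_mul]
        ring
      · simp only [col_concat_apply_inr, Sum.elim_inr, hdΦ, Matrix.add_apply, Matrix.smul_apply,
          Matrix.of_apply, smul_eq_mul]
        ring
    rw [h2]
    refine h1.trans_eq ?_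
    simp only [Fintype.sum_sum_type, Finset.univ_unique, Finset.sum_singleton, Sum.elim_inl,
      Sum.elim_inr, col_concat_apply_inl, col_concat_apply_inr, hq, g]
  have hgr' := mul_le_mul_of_nonneg_left hgr (mul_nonneg h₂ hK)
  unfold typeBObjective penalty at hmin
  rw [hres, l2norm_add_smul_sq, hl1] at hmin
  nlinarith

lemma sq_mul_le_of_mul_le {l K J N c : ℝ} (hl : 0 ≤ l) (hK : 0 < K) (hJ : 0 ≤ J)
    (h : l * K * J ≤ N * (K * (c * √J))) : l ^ 2 * J ≤ c ^ 2 * N ^ 2 := by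
  rcases hJ.eq_or_lt with rfl | hJ'
  · simp only [mul_zero]; positivity
  · have hs : 0 < √J := Real.sqrt_pos.2 hJ'
    have h1 : l * √J ≤ c * N := by
      have h2 : (K * √J) * (l * √J) ≤ (K * √J) * (c * N) := by
        calc (K * √J) * (l * √J) = l * K * (√J ^ 2) := by ring
          _ = l * K * J := by rw [Real.sq_sqrt hJ]
          _ ≤ _ := h
          _ = _ := by ring
      exact le_of_mul_le_mul_left h2 (by positivity)
    calc l ^ 2 * J = (l * √J) ^ 2 := by rw [mul_pow, Real.sq_sqrt hJ]
      _ ≤ (c * N) ^ 2 := by gcongr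
      _ = _ := by ring

/-- The residual, projected on the selected predictors. -/
noncomputable def projResidual (X : Matrix (Fin n) (Fin p) ℝ) (y : Fin n → ℝ) (b : Fin p → ℝ)
    (Φ : Matrix (Fin p) (Fin p) ℝ) : ℝ :=
  ‖(colSpan (fullS X) (predSupp b Φ)).starProjection (WithLp.toLp 2 (y - signalS X b Φ))‖

/-- The test signal lies in the selected span, so only the projected residual matters. The operator
norm contributes the factor K that the penalty levels also carry. -/
lemma inner_residual_le (X : Matrix (Fin n) (Fin p) ℝ) (y : Fin n → ℝ) (b b' : Fin p → ℝ)
    (Φ Φ' : Matrix (Fin p) (Fin p) ℝ) (hb : ∀ j, b j = 0 → b' j = 0)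
    (hΦ : ∀ k j, Φ k j = 0 → Φ' k j = 0) {B : ℝ}
    (hB : ∑ j, b' j ^ 2 + ∑ j, ∑ k, Φ' k j ^ 2 ≤ B) :
    inner ℝ (WithLp.toLp 2 (y - signalS X b Φ)) (WithLp.toLp 2 (signalS X b' Φ')) ≤
      projResidual X y b Φ * (specNorm (fullS X) * √B) := by
  refine (inner_le_norm_starProjection_mul _ _
    (toLp_signalS_mem_colSpan X _ subset_rfl hb hΦ)).trans ?_
  refine mul_le_mul_of_nonneg_left ?_ (norm_nonneg _)
  have h1 : l2norm (signalS X b' Φ') ≤ specNorm (fullS X) * l2norm (Sum.elim b' Φ'.vec) := by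
    rw [signalS_eq]
    exact l2norm_mulVec_le _ _
  refine h1.trans (mul_le_mul_of_nonneg_left ?_ (specNorm_nonneg _))
  refine Real.le_sqrt_of_sq_le ?_
  rw [l2norm_sq, Fintype.sum_sum_type]
  simp only [Sum.elim_inl, Sum.elim_inr]
  rwa [sum_vec (fun x => x ^ 2)]

lemma sum_ne_zero_eq_card_Je (Φ : Matrix (Fin p) (Fin p) ℝ) :
    ∑ j, ∑ k, (if Φ k j = 0 then (0 : ℝ) else 1) = (Je Φ).card := by
  rw [← sum_vec (fun x => if x = 0 then (0 : ℝ) else 1), Je, Finset.card_filter]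
  push_cast
  exact Finset.sum_congr rfl fun jk _ => by split_ifs <;> simp_all

lemma sum_ne_zero_eq_card_JG (b : Fin p → ℝ) (Φ : Matrix (Fin p) (Fin p) ℝ) :
    ∑ j, (if l2norm ((concat b Φ).col j) = 0 then (0 : ℝ) else 1) = (JG b Φ).card := by
  have h : JG b Φ = Finset.univ.filter fun j => ¬ l2norm ((concat b Φ).col j) = 0 := by
    ext j
    rw [mem_JG]
    simp
  rw [h, Finset.card_filter]
  push_cast
  exact Finset.sum_congr rfl fun jk _ => by simp [ite_not]

/-- The number of selected interactions is controlled by the projected residual. -/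
lemma IsTypeBMinimizer.sq_mul_card_Je_le {X : Matrix (Fin n) (Fin p) ℝ} {y : Fin n → ℝ}
    {l₁ l₂ : ℝ} {bh : Fin p → ℝ} {Φh : Matrix (Fin p) (Fin p) ℝ}
    (h : IsTypeBMinimizer X y l₁ l₂ bh Φh) (h₁ : 0 ≤ l₁) (h₂ : 0 ≤ l₂)
    (hK : 0 < specNorm (fullS X)) :
    l₁ ^ 2 * (Je Φh).card ≤ projResidual X y bh Φh ^ 2 := by
  -- The weights 1/|φ| turn Φ̂ into its sign matrix (with 0⁻¹ = 0), which is symmetric and has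
  -- squared norm Ĵ_e.
  have hkkt := h.le_inner_residual h₂ 0 (Matrix.of fun k j => |Φh k j|⁻¹)
    (fun k j => inv_nonneg.2 (abs_nonneg _))
    (fun k j => by
      have : Φh k j = Φh j k := congrFun (congrFun h.1 k) j
      simp [this])
  have h3 : ∀ k j, |Φh k j|⁻¹ * |Φh k j| = if Φh k j = 0 then 0 else 1 := by
    intro k j
    split_ifs with h0
    · simp [h0]
    · exact inv_mul_cancel₀ (abs_ne_zero.2 h0)
  simp only [Matrix.of_apply, h3, sum_ne_zero_eq_card_Je, Pi.zero_apply, zero_mul, zero_add]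
    at hkkt
  -- The group penalty shrinks as well, so its contribution has a favourable sign and is dropped.
  have h4 : 0 ≤ ∑ j, (∑ k, |Φh k j|⁻¹ * Φh k j ^ 2) / l2norm ((concat bh Φh).col j) :=
    Finset.sum_nonneg fun j _ => div_nonneg (Finset.sum_nonneg fun k _ => by positivity)
      (l2norm_nonneg _)
  have h5 := mul_nonneg (mul_nonneg h₂ hK.le) h4
  have h6 := inner_residual_le X y bh (fun _ => 0) Φh (Matrix.of fun k j => |Φh k j|⁻¹ * Φh k j)
    (fun _ _ => rfl) (fun k j h0 => by simp [h0]) (B := (Je Φh).card) (by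
      rw [← sum_ne_zero_eq_card_Je]
      simp only [ne_eq, OfNat.ofNat_ne_zero, not_false_eq_true, zero_pow, Finset.sum_const_zero,
        zero_add, Matrix.of_apply]
      refine Finset.sum_le_sum fun j _ => Finset.sum_le_sum fun k _ => ?_
      rw [← sq_abs, abs_mul, abs_inv, abs_abs, h3]
      split_ifs <;> simp)
  have h7 := sq_mul_le_of_mul_le (c := 1) (N := projResidual X y bh Φh) h₁ hK
    (Nat.cast_nonneg (Je Φh).card) (by rw [one_mul]; linarith)
  simpa using h7

/-- The number of selected groups is controlled by the projected residual. -/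
lemma IsTypeBMinimizer.sq_mul_card_JG_le {X : Matrix (Fin n) (Fin p) ℝ} {y : Fin n → ℝ}
    {l₁ l₂ : ℝ} {bh : Fin p → ℝ} {Φh : Matrix (Fin p) (Fin p) ℝ}
    (h : IsTypeBMinimizer X y l₁ l₂ bh Φh) (h₁ : 0 ≤ l₁) (h₂ : 0 ≤ l₂)
    (hK : 0 < specNorm (fullS X)) :
    l₂ ^ 2 * (JG bh Φh).card ≤ 4 * projResidual X y bh Φh ^ 2 := by
  set g : Fin p → ℝ := fun j => l2norm ((concat bh Φh).col j) with hg
  have hg0 : ∀ j, 0 ≤ g j := fun j => l2norm_nonneg _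
  have hgsq : ∀ j, g j ^ 2 = bh j ^ 2 + ∑ k, Φh k j ^ 2 := fun j => l2norm_col_concat_sq _ _ _
  have hsym : ∀ k j, Φh k j = Φh j k := fun k j => congrFun (congrFun h.1 k) j
  have hcard := sum_ne_zero_eq_card_JG bh Φh
  -- The group subgradient direction φ_kj/g_j is not symmetric; adding its transpose keeps the test
  -- direction feasible. The extra terms only increase the penalty side. Doubling the main effect
  -- weight makes the squared norm at most 4 per selected group.
  have hkkt := h.le_inner_residual h₂ (fun j => 2 * (g j)⁻¹)
    (Matrix.of fun k j => (g j)⁻¹ + (g k)⁻¹)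
    (fun k j => add_nonneg (inv_nonneg.2 (hg0 j)) (inv_nonneg.2 (hg0 k)))
    (fun k j => add_comm _ _)
  simp only [Matrix.of_apply] at hkkt
  have h3 : 0 ≤ ∑ j, ∑ k, ((g j)⁻¹ + (g k)⁻¹) * |Φh k j| :=
    Finset.sum_nonneg fun j _ => Finset.sum_nonneg fun k _ =>
      mul_nonneg (add_nonneg (inv_nonneg.2 (hg0 j)) (inv_nonneg.2 (hg0 k))) (abs_nonneg _)
  have h4 : ((JG bh Φh).card : ℝ) ≤
      ∑ j, (2 * (g j)⁻¹ * bh j ^ 2 + ∑ k, ((g j)⁻¹ + (g k)⁻¹) * Φh k j ^ 2) / g j := by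
    rw [← hcard]
    refine Finset.sum_le_sum fun j _ => ?_
    change (if g j = 0 then (0 : ℝ) else 1) ≤ _
    split_ifs with h0
    · simp [h0]
    · have hpos : 0 < g j := lt_of_le_of_ne (hg0 j) (Ne.symm h0)
      rw [le_div_iff₀ hpos, one_mul]
      have h5 : g j = (g j)⁻¹ * bh j ^ 2 + ∑ k, (g j)⁻¹ * Φh k j ^ 2 := by
        rw [← Finset.mul_sum, ← mul_add, ← hgsq]
        field_simp
      conv_lhs => rw [h5]
      refine add_le_add ?_ (Finset.sum_le_sum fun k _ => ?_)
      · have : 0 ≤ (g j)⁻¹ * bh j ^ 2 := by positivity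
        linarith
      · have := hg0 k
        gcongr
        exact le_add_of_nonneg_right (inv_nonneg.2 this)
  have h5 : ∑ j, (2 * (g j)⁻¹ * bh j) ^ 2 + ∑ j, ∑ k, (((g j)⁻¹ + (g k)⁻¹) * Φh k j) ^ 2 ≤
      2 ^ 2 * (JG bh Φh).card := by
    have h6 : ∀ k j, (((g j)⁻¹ + (g k)⁻¹) * Φh k j) ^ 2 ≤
        2 * ((g j)⁻¹ * Φh k j) ^ 2 + 2 * ((g k)⁻¹ * Φh j k) ^ 2 := by
      intro k j
      rw [hsym j k]
      nlinarith [sq_nonneg ((g j)⁻¹ * Φh k j - (g k)⁻¹ * Φh k j)]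
    have h7 : ∑ j, ∑ k, (((g j)⁻¹ + (g k)⁻¹) * Φh k j) ^ 2 ≤
        4 * ∑ j, ∑ k, ((g j)⁻¹ * Φh k j) ^ 2 := by
      calc _ ≤ ∑ j, ∑ k, (2 * ((g j)⁻¹ * Φh k j) ^ 2 + 2 * ((g k)⁻¹ * Φh j k) ^ 2) :=
            Finset.sum_le_sum fun j _ => Finset.sum_le_sum fun k _ => h6 k j
        _ = 2 * ∑ j, ∑ k, ((g j)⁻¹ * Φh k j) ^ 2 + 2 * ∑ j, ∑ k, ((g k)⁻¹ * Φh j k) ^ 2 := by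
            simp_rw [Finset.sum_add_distrib, Finset.mul_sum]
        _ = _ := by
            rw [Finset.sum_comm (f := fun j k => ((g k)⁻¹ * Φh j k) ^ 2)]
            ring
    refine (add_le_add le_rfl h7).trans_eq ?_
    rw [← hcard, Finset.mul_sum, Finset.mul_sum, ← Finset.sum_add_distrib]
    refine Finset.sum_congr rfl fun j _ => ?_
    change _ = 2 ^ 2 * (if g j = 0 then (0 : ℝ) else 1)
    simp_rw [mul_pow]
    rw [← Finset.mul_sum]
    have h8 : 2 ^ 2 * (g j)⁻¹ ^ 2 * bh j ^ 2 + 4 * ((g j)⁻¹ ^ 2 * ∑ k, Φh k j ^ 2) =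
        4 * ((g j)⁻¹ * g j) ^ 2 := by
      rw [mul_pow, hgsq]; ring
    rw [h8]
    split_ifs with h0
    · simp [h0]
    · rw [inv_mul_cancel₀ h0]; norm_num
  have h6 := inner_residual_le X y bh (fun j => 2 * (g j)⁻¹ * bh j) Φh
    (Matrix.of fun k j => ((g j)⁻¹ + (g k)⁻¹) * Φh k j)
    (fun j h0 => by simp [h0]) (fun k j h0 => by simp [h0]) h5
  rw [Real.sqrt_mul (by norm_num), Real.sqrt_sq (by norm_num)] at h6
  have h7 := mul_nonneg (mul_nonneg h₁ hK.le) h3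
  have h8 := mul_le_mul_of_nonneg_left h4 (mul_nonneg h₂ hK.le)
  have h9 := sq_mul_le_of_mul_le (c := 2) (N := projResidual X y bh Φh) h₂ hK
    (Nat.cast_nonneg (JG bh Φh).card) (by linarith)
  linarith

/-! ### The deterministic oracle inequality -/

/-- The selected predictors of a minimizer are few when its prediction error is small. -/
lemma IsTypeBMinimizer.card_le {X : Matrix (Fin n) (Fin p) ℝ} {m e : Fin n → ℝ}
    {A₁ A₂ σ τ : ℝ} {bh : Fin p → ℝ} {Φh : Matrix (Fin p) (Fin p) ℝ}
    (hA₁ : 26 ≤ A₁) (hA₂ : 26 ≤ A₂) (hσ : 0 < σ) (hτ : 0 < τ) (hK : 0 < specNorm (fullS X))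
    (h : IsTypeBMinimizer X (m + e) (A₁ * σ * √τ) (A₂ * σ * √τ) bh Φh) :
    σ ^ 2 * τ * ((Je Φh).card + (JG bh Φh).card) ≤
      1 / 32 * (l2norm (signalS X bh Φh - m) ^ 2 + noiseRem (fullS X) σ τ e) := by
  have hl₁ : 0 ≤ A₁ * σ * √τ := by positivity
  have hl₂ : 0 ≤ A₂ * σ * √τ := by positivity
  have h1 := h.sq_mul_card_Je_le hl₁ hl₂ hK
  have h2 := h.sq_mul_card_JG_le hl₁ hl₂ hK
  rw [mul_pow, mul_pow, Real.sq_sqrt hτ.le] at h1 h2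
  have hA₁' : (26 : ℝ) ^ 2 ≤ A₁ ^ 2 := by gcongr
  have hA₂' : (26 : ℝ) ^ 2 ≤ A₂ ^ 2 := by gcongr
  have h3 := norm_starProjection_sq_le (fullS X) hσ τ e (predSupp bh Φh)
  have h4 := card_predSupp_le bh Φh
  set N := projResidual X (m + e) bh Φh with hN
  set V := colSpan (fullS X) (predSupp bh Φh) with hV
  set E := ‖V.starProjection (WithLp.toLp 2 e)‖ with hE
  set d := l2norm (signalS X bh Φh - m) with hd
  set R := noiseRem (fullS X) σ τ e
  have h5 : N ≤ E + d := by
    -- The residual is noise minus prediction error, so N ≤ E + d.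
    have h6 : m + e - signalS X bh Φh = e + -(signalS X bh Φh - m) := by abel
    rw [hN, projResidual, h6, WithLp.toLp_add, map_add]
    refine (norm_add_le _ _).trans (add_le_add le_rfl ?_)
    refine (Submodule.norm_starProjection_apply_le _ _).trans_eq ?_
    rw [hd, ← l2norm_neg]
    rfl
  have hN0 : 0 ≤ N := norm_nonneg _
  have h6 : N ^ 2 ≤ 2 * E ^ 2 + 2 * d ^ 2 := by nlinarith [sq_nonneg (E - d)]
  have hst : 0 < σ ^ 2 * τ := by positivity
  have h7 : σ ^ 2 * τ * (predSupp bh Φh).card ≤ σ ^ 2 * τ * ((Je Φh).card + (JG bh Φh).card) := by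
    gcongr
  have h8 : 26 ^ 2 * (σ ^ 2 * τ * (Je Φh).card) ≤ A₁ ^ 2 * (σ ^ 2 * τ * (Je Φh).card) := by
    gcongr
  have h9 : 26 ^ 2 * (σ ^ 2 * τ * (JG bh Φh).card) ≤ A₂ ^ 2 * (σ ^ 2 * τ * (JG bh Φh).card) := by
    gcongr
  have hR := noiseRem_nonneg (fullS X) σ τ e
  -- With J = Ĵ_e + Ĵ_G: 26²σ²τJ ≤ 5N² ≤ 10E² + 10d² ≤ 80σ²τJ + 10R + 10d², and 10/(676 - 80) ≤
  -- 1/32.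
  nlinarith [sq_nonneg d]

lemma sq_sum_add_sum_le {ι κ : Type*} (s : Finset ι) (t : Finset κ) (f : ι → ℝ) (g : κ → ℝ) :
    (∑ i ∈ s, f i + ∑ j ∈ t, g j) ^ 2 ≤
      (s.card + t.card) * (∑ i ∈ s, f i ^ 2 + ∑ j ∈ t, g j ^ 2) := by
  have := sq_sum_le_card_mul_sum_sq (s := s.disjSum t) (f := Sum.elim f g)
  simpa [Finset.sum_disjSum, Finset.card_disjSum] using this

/-- The difference of the penalties is dominated on the support of the reference. -/
lemma penalty_sub_penalty_le {l₁ l₂ : ℝ} (h₁ : 0 ≤ l₁) (h₂ : 0 ≤ l₂)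
    (b bh : Fin p → ℝ) (Φ Φh : Matrix (Fin p) (Fin p) ℝ) :
    penalty l₁ l₂ b Φ - penalty l₁ l₂ bh Φh ≤
      max l₁ l₂ * (∑ jk ∈ Je Φ, |(Φh - Φ).vec jk| +
          ∑ j ∈ JG b Φ, l2norm ((concat (bh - b) (Φh - Φ)).col j)) -
        min l₁ l₂ * (∑ jk ∈ (Je Φ)ᶜ, |(Φh - Φ).vec jk| +
          ∑ j ∈ (JG b Φ)ᶜ, l2norm ((concat (bh - b) (Φh - Φ)).col j)) := by
  have hsplit : ∀ j, (concat bh Φh).col j =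
      (concat b Φ).col j + (concat (bh - b) (Φh - Φ)).col j := by
    intro j
    rw [← col_concat_add]
    simp
  have e1 : ∑ jk, |Φ.vec jk| - ∑ jk, |Φh.vec jk| ≤
      ∑ jk ∈ Je Φ, |(Φh - Φ).vec jk| - ∑ jk ∈ (Je Φ)ᶜ, |(Φh - Φ).vec jk| := by
    rw [← Finset.sum_add_sum_compl (Je Φ) fun jk => |Φ.vec jk|,
      ← Finset.sum_add_sum_compl (Je Φ) fun jk => |Φh.vec jk|]
    have a1 : ∑ jk ∈ Je Φ, |Φ.vec jk| ≤
        ∑ jk ∈ Je Φ, |Φh.vec jk| + ∑ jk ∈ Je Φ, |(Φh - Φ).vec jk| := by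
      rw [← Finset.sum_add_distrib]
      refine Finset.sum_le_sum fun jk _ => ?_
      have h1 := abs_sub (Φh.vec jk) (Φh.vec jk - Φ.vec jk)
      rwa [sub_sub_cancel] at h1
    have a2 : ∀ jk ∈ (Je Φ)ᶜ, Φ.vec jk = 0 := by
      intro jk hjk
      rw [Finset.mem_compl, mem_Je, not_not] at hjk
      exact hjk
    have a3 : ∑ jk ∈ (Je Φ)ᶜ, |Φ.vec jk| = 0 :=
      Finset.sum_eq_zero fun jk hjk => by rw [a2 jk hjk, abs_zero]
    have a4 : ∑ jk ∈ (Je Φ)ᶜ, |(Φh - Φ).vec jk| = ∑ jk ∈ (Je Φ)ᶜ, |Φh.vec jk| := by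
      refine Finset.sum_congr rfl fun jk hjk => ?_
      rw [Matrix.vec_sub, Pi.sub_apply, a2 jk hjk, sub_zero]
    linarith
  have e2 : ∑ j, l2norm ((concat b Φ).col j) - ∑ j, l2norm ((concat bh Φh).col j) ≤
      ∑ j ∈ JG b Φ, l2norm ((concat (bh - b) (Φh - Φ)).col j) -
        ∑ j ∈ (JG b Φ)ᶜ, l2norm ((concat (bh - b) (Φh - Φ)).col j) := by
    rw [← Finset.sum_add_sum_compl (JG b Φ) fun j => l2norm ((concat b Φ).col j),
      ← Finset.sum_add_sum_compl (JG b Φ) fun j => l2norm ((concat bh Φh).col j)]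
    have a1 : ∑ j ∈ JG b Φ, l2norm ((concat b Φ).col j) ≤
        ∑ j ∈ JG b Φ, l2norm ((concat bh Φh).col j) +
          ∑ j ∈ JG b Φ, l2norm ((concat (bh - b) (Φh - Φ)).col j) := by
      rw [← Finset.sum_add_distrib]
      refine Finset.sum_le_sum fun j _ => ?_
      have h1 : (concat b Φ).col j =
          (concat bh Φh).col j + -(concat (bh - b) (Φh - Φ)).col j := by
        rw [hsplit]; abel
      rw [h1, ← l2norm_neg ((concat (bh - b) (Φh - Φ)).col j)]
      exact l2norm_add_le _ _
    have a2 : ∀ j ∈ (JG b Φ)ᶜ, l2norm ((concat b Φ).col j) = 0 := by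
      intro j hj
      rw [Finset.mem_compl, mem_JG, not_not] at hj
      exact hj
    have a3 : ∑ j ∈ (JG b Φ)ᶜ, l2norm ((concat b Φ).col j) = 0 := Finset.sum_eq_zero a2
    have a4 : ∑ j ∈ (JG b Φ)ᶜ, l2norm ((concat (bh - b) (Φh - Φ)).col j) =
        ∑ j ∈ (JG b Φ)ᶜ, l2norm ((concat bh Φh).col j) := by
      refine Finset.sum_congr rfl fun j hj => ?_
      rw [hsplit, l2norm_eq_zero.1 (a2 j hj), zero_add]
    linarith
  have n1 : 0 ≤ ∑ jk ∈ Je Φ, |(Φh - Φ).vec jk| := Finset.sum_nonneg fun _ _ => abs_nonneg _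
  have n2 : 0 ≤ ∑ jk ∈ (Je Φ)ᶜ, |(Φh - Φ).vec jk| := Finset.sum_nonneg fun _ _ => abs_nonneg _
  have n3 : 0 ≤ ∑ j ∈ JG b Φ, l2norm ((concat (bh - b) (Φh - Φ)).col j) :=
    Finset.sum_nonneg fun _ _ => l2norm_nonneg _
  have n4 : 0 ≤ ∑ j ∈ (JG b Φ)ᶜ, l2norm ((concat (bh - b) (Φh - Φ)).col j) :=
    Finset.sum_nonneg fun _ _ => l2norm_nonneg _
  have f1 := mul_le_mul_of_nonneg_left e1 h₁
  have f2 := mul_le_mul_of_nonneg_left e2 h₂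
  have g1 := mul_le_mul_of_nonneg_right (le_max_left l₁ l₂) n1
  have g2 := mul_le_mul_of_nonneg_right (min_le_left l₁ l₂) n2
  have g3 := mul_le_mul_of_nonneg_right (le_max_right l₁ l₂) n3
  have g4 := mul_le_mul_of_nonneg_right (min_le_right l₁ l₂) n4
  unfold penalty
  linarith

/-- Under the restricted eigenvalue condition the difference of the penalties is controlled by the
distance of the signals. -/
lemma REScaled.penalty_sub_penalty_le {X : Matrix (Fin n) (Fin p) ℝ} {l₁ l₂ ϑ κ : ℝ}
    {b : Fin p → ℝ} {Φ : Matrix (Fin p) (Fin p) ℝ} (hRE : REScaled X (Je Φ) (JG b Φ) ϑ κ)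
    (h₁ : 0 ≤ l₁) (h₂ : 0 ≤ l₂) (hϑ : max l₁ l₂ ≤ (1 + ϑ) * min l₁ l₂) (hκ : 0 < κ)
    (hK : 0 < specNorm (fullS X)) (hΦ : Φ = Φᵀ)
    (bh : Fin p → ℝ) {Φh : Matrix (Fin p) (Fin p) ℝ} (hΦh : Φh = Φhᵀ) :
    penalty (l₁ * specNorm (fullS X)) (l₂ * specNorm (fullS X)) b Φ -
        penalty (l₁ * specNorm (fullS X)) (l₂ * specNorm (fullS X)) bh Φh ≤
      1 / 4 * l2norm (signalS X (bh - b) (Φh - Φ)) ^ 2 +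
        max l₁ l₂ ^ 2 / κ * ((Je Φ).card + (JG b Φ).card) := by
  set K := specNorm (fullS X)
  have h := Gresh.penalty_sub_penalty_le (mul_nonneg h₁ hK.le) (mul_nonneg h₂ hK.le) b bh Φ Φh
  rw [← max_mul_of_nonneg _ _ hK.le, ← min_mul_of_nonneg _ _ hK.le] at h
  refine h.trans ?_
  have hre := hRE (bh - b) (Φh - Φ) (by rw [Matrix.transpose_sub, ← hΦ, ← hΦh])
  have hcs := sq_sum_add_sum_le (Je Φ) (JG b Φ) (fun jk => |(Φh - Φ).vec jk|)
    (fun j => l2norm ((concat (bh - b) (Φh - Φ)).col j))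
  simp only [sq_abs] at hcs
  have non : 0 ≤ ∑ jk ∈ Je Φ, |(Φh - Φ).vec jk| +
      ∑ j ∈ JG b Φ, l2norm ((concat (bh - b) (Φh - Φ)).col j) :=
    add_nonneg (Finset.sum_nonneg fun _ _ => abs_nonneg _)
      (Finset.sum_nonneg fun _ _ => l2norm_nonneg _)
  set on := ∑ jk ∈ Je Φ, |(Φh - Φ).vec jk| +
      ∑ j ∈ JG b Φ, l2norm ((concat (bh - b) (Φh - Φ)).col j)
  have noff : 0 ≤ ∑ jk ∈ (Je Φ)ᶜ, |(Φh - Φ).vec jk| +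
      ∑ j ∈ (JG b Φ)ᶜ, l2norm ((concat (bh - b) (Φh - Φ)).col j) :=
    add_nonneg (Finset.sum_nonneg fun _ _ => abs_nonneg _)
      (Finset.sum_nonneg fun _ _ => l2norm_nonneg _)
  set off := ∑ jk ∈ (Je Φ)ᶜ, |(Φh - Φ).vec jk| +
      ∑ j ∈ (JG b Φ)ᶜ, l2norm ((concat (bh - b) (Φh - Φ)).col j)
  set Q := ∑ jk ∈ Je Φ, (Φh - Φ).vec jk ^ 2 +
    ∑ j ∈ JG b Φ, l2norm ((concat (bh - b) (Φh - Φ)).col j) ^ 2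
  set D := l2norm (signalS X (bh - b) (Φh - Φ)) ^ 2 with hD
  have hD0 : 0 ≤ D := sq_nonneg _
  have hJ0 : (0 : ℝ) ≤ (Je Φ).card + (JG b Φ).card :=
    add_nonneg (Nat.cast_nonneg _) (Nat.cast_nonneg _)
  set J : ℝ := (Je Φ).card + (JG b Φ).card
  set M := max l₁ l₂
  set μ := min l₁ l₂
  have hM0 : 0 ≤ M := le_max_of_le_left h₁
  have hμ0 : 0 ≤ μ := le_min h₁ h₂
  clear_value J M μ on off Q
  -- Inside the cone, Cauchy–Schwarz and the eigenvalue bound give (M K on)² ≤ D·(M²J/κ), and 4ab ≤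
  -- (a + b)² with a = D/4 finishes. Outside it, the condition on ϑ gives M K on ≤ μ K off, so the
  -- difference is at most 0.
  by_cases hc : off ≤ (1 + ϑ) * on
  · have h3 := hre hc
    have h4 : (M * K * on) ^ 2 ≤ D * (M ^ 2 / κ * J) := by
      calc (M * K * on) ^ 2 = M ^ 2 * K ^ 2 * on ^ 2 := by ring
        _ ≤ M ^ 2 * K ^ 2 * (J * Q) := by gcongr
        _ = (κ * K ^ 2 * Q) * (M ^ 2 / κ * J) := by field_simp
        _ ≤ D * (M ^ 2 / κ * J) := by gcongr
    have h5 : M * K * on ≤ 1 / 4 * D + M ^ 2 / κ * J := by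
      refine abs_le_of_sq_le_sq' ?_ (by positivity) |>.2
      nlinarith [sq_nonneg (1 / 4 * D - M ^ 2 / κ * J)]
    have h6 : 0 ≤ μ * K * off := by positivity
    linarith
  · push Not at hc
    have h3 : M * K * on ≤ μ * K * off := by
      calc M * K * on ≤ (1 + ϑ) * μ * K * on := by gcongr
        _ = μ * K * ((1 + ϑ) * on) := by ring
        _ ≤ μ * K * off := by gcongr
    have h4 : 0 ≤ 1 / 4 * D + M ^ 2 / κ * J := by positivity
    linarith

/-- The oracle inequality for the scaled coefficients, with the noise remainder. -/
lemma IsTypeBMinimizer.oracle_le {X : Matrix (Fin n) (Fin p) ℝ} {m e : Fin n → ℝ}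
    {A₁ A₂ σ τ ϑ κ : ℝ} {bh b : Fin p → ℝ} {Φh Φ : Matrix (Fin p) (Fin p) ℝ}
    (hA₁ : 26 ≤ A₁) (hA₂ : 26 ≤ A₂) (hσ : 0 < σ) (hτ : 0 < τ) (hK : 0 < specNorm (fullS X))
    (h : IsTypeBMinimizer X (m + e) (A₁ * σ * √τ) (A₂ * σ * √τ) bh Φh)
    (hΦ : Φ = Φᵀ) (hϑ : max A₁ A₂ ≤ (1 + ϑ) * min A₁ A₂) (hκ : 0 < κ)
    (hRE : REScaled X (Je Φ) (JG b Φ) ϑ κ) :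
    l2norm (signalS X bh Φh - m) ^ 2 ≤ 2 * l2norm (signalS X b Φ - m) ^ 2 +
      5 * noiseRem (fullS X) σ τ e +
      4 * (8 + max A₁ A₂ ^ 2) * (max 1 (1 / κ) * (σ ^ 2 * τ * ((Je Φ).card + (JG b Φ).card))) := by
  classical
  have hst : 0 ≤ σ * √τ := by positivity
  have hl₁ : 0 ≤ A₁ * σ * √τ := by positivity
  have hl₂ : 0 ≤ A₂ * σ * √τ := by positivity
  have hmax : max (A₁ * σ * √τ) (A₂ * σ * √τ) = max A₁ A₂ * (σ * √τ) := by
    rw [max_mul_of_nonneg _ _ hst, mul_assoc, mul_assoc]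
  have hmin : min (A₁ * σ * √τ) (A₂ * σ * √τ) = min A₁ A₂ * (σ * √τ) := by
    rw [min_mul_of_nonneg _ _ hst, mul_assoc, mul_assoc]
  have hpen := hRE.penalty_sub_penalty_le hl₁ hl₂ (by
    rw [hmax, hmin, ← mul_assoc (1 + ϑ)]
    exact mul_le_mul_of_nonneg_right hϑ hst) hκ hK hΦ bh h.1
  have hobj := h.objective_add_le hl₁ hl₂ b Φ hΦ
  have hcard := h.card_le hA₁ hA₂ hσ hτ hK
  rw [hmax] at hpen
  -- This S is random, which is why the noise bound must be uniform in S.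
  set S := predSupp bh Φh ∪ predSupp b Φ
  set s := signalS X (bh - b) (Φh - Φ) with hs
  have hmem : WithLp.toLp 2 s ∈ colSpan (fullS X) S := by
    rw [hs, signalS_sub, WithLp.toLp_sub]
    exact Submodule.sub_mem _
      (toLp_signalS_mem_colSpan X S Finset.subset_union_left (fun _ h => h) fun _ _ h => h)
      (toLp_signalS_mem_colSpan X S Finset.subset_union_right (fun _ h => h) fun _ _ h => h)
  have hinner := inner_le_norm_starProjection_mul (colSpan (fullS X) S) (WithLp.toLp 2 e) hmem
  have hnoise := norm_starProjection_sq_le (fullS X) hσ τ e S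
  have hS : (S.card : ℝ) ≤ ((Je Φh).card + (JG bh Φh).card) + ((Je Φ).card + (JG b Φ).card) := by
    have h1 : (S.card : ℝ) ≤ (predSupp bh Φh).card + (predSupp b Φ).card := by
      exact_mod_cast Finset.card_union_le _ _
    exact h1.trans (add_le_add (card_predSupp_le _ _) (card_predSupp_le _ _))
  set E := ‖(colSpan (fullS X) S).starProjection (WithLp.toLp 2 e)‖
  change _ ≤ E * l2norm s at hinner
  have hr1 : m + e - signalS X b Φ = -(signalS X b Φ - m) + (1 : ℝ) • e := by
    rw [one_smul]; abel
  have hr2 : m + e - signalS X bh Φh = -(signalS X bh Φh - m) + (1 : ℝ) • e := by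
    rw [one_smul]; abel
  have hin : inner ℝ (WithLp.toLp 2 (-(signalS X b Φ - m))) (WithLp.toLp 2 e) -
      inner ℝ (WithLp.toLp 2 (-(signalS X bh Φh - m))) (WithLp.toLp 2 e) =
      inner ℝ (WithLp.toLp 2 e) (WithLp.toLp 2 s) := by
    rw [← inner_sub_left, ← WithLp.toLp_sub, real_inner_comm]
    congr 2
    rw [hs, signalS_sub]
    abel
  unfold typeBObjective at hobj
  rw [hr1, hr2, l2norm_add_smul_sq, l2norm_add_smul_sq, l2norm_neg, l2norm_neg] at hobj
  set R := noiseRem (fullS X) σ τ e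
  set Jh : ℝ := (Je Φh).card + (JG bh Φh).card
  set J : ℝ := (Je Φ).card + (JG b Φ).card
  have hJ0 : 0 ≤ J := add_nonneg (Nat.cast_nonneg _) (Nat.cast_nonneg _)
  set M := max A₁ A₂
  clear_value J Jh M
  have hstτ : (σ * √τ) ^ 2 = σ ^ 2 * τ := by rw [mul_pow, Real.sq_sqrt hτ.le]
  rw [mul_pow, hstτ] at hpen
  have hES : σ ^ 2 * τ * S.card ≤ σ ^ 2 * τ * (Jh + J) := by gcongr
  have hq : M ^ 2 * (σ ^ 2 * τ) / κ * J ≤ M ^ 2 * (max 1 (1 / κ) * (σ ^ 2 * τ * J)) := by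
    calc M ^ 2 * (σ ^ 2 * τ) / κ * J = M ^ 2 * (1 / κ * (σ ^ 2 * τ * J)) := by ring
      _ ≤ _ := by gcongr; exact le_max_right _ _
  have hq2 : σ ^ 2 * τ * J ≤ max 1 (1 / κ) * (σ ^ 2 * τ * J) :=
    le_mul_of_one_le_left (by positivity) (le_max_left _ _)
  have hamgm : E * l2norm s ≤ E ^ 2 + 1 / 4 * l2norm s ^ 2 := by
    nlinarith [sq_nonneg (E - 1 / 2 * l2norm s)]
  set T := max 1 (1 / κ) * (σ ^ 2 * τ * J)
  -- The two quarters of ‖s‖² cancel the gain ½‖s‖². In E² ≤ 8σ²τ(Jh + J) + R the part with Jh is at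
  -- most (d² + R)/4, leaving d²/4 on the left; multiplication by 4 gives the constants 2, 5 and 4(8
  -- + M²).
  nlinarith

/-! ### The original and the scaled coefficients -/

/-- The scaled main effects that correspond to `b`. -/
noncomputable def scaleMain (X : Matrix (Fin n) (Fin p) ℝ) (b : Fin p → ℝ) : Fin p → ℝ :=
  fun j => b j * l2norm (X.col j)

/-- The scaled interactions that correspond to `Φ`. -/
noncomputable def scaleInter (X : Matrix (Fin n) (Fin p) ℝ) (Φ : Matrix (Fin p) (Fin p) ℝ) :
    Matrix (Fin p) (Fin p) ℝ :=
  Matrix.of fun k j => Φ k j * l2norm ((interactions X).col (j, k))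

/-- The scale factors are symmetric in (j, k), so scaling preserves the constraint Φ = Φᵀ. -/
lemma l2norm_col_interactions_comm (X : Matrix (Fin n) (Fin p) ℝ) (j k : Fin p) :
    l2norm ((interactions X).col (j, k)) = l2norm ((interactions X).col (k, j)) := by
  congr 1
  ext i
  exact mul_comm _ _

lemma scaleInter_symm (X : Matrix (Fin n) (Fin p) ℝ) {Φ : Matrix (Fin p) (Fin p) ℝ}
    (hΦ : Φ = Φᵀ) : scaleInter X Φ = (scaleInter X Φ)ᵀ := by
  ext k j
  have : Φ k j = Φ j k := congrFun (congrFun hΦ k) j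
  simp [scaleInter, this, l2norm_col_interactions_comm X j k]

lemma mulVec_eq_colScale_mulVec {ι : Type*} [Fintype ι] (Z : Matrix (Fin n) ι ℝ)
    (hZ : ∀ j, Z.col j ≠ 0) {v vs : ι → ℝ} (h : ∀ j, vs j = v j * l2norm (Z.col j)) :
    Z *ᵥ v = colScale Z *ᵥ vs := by
  ext i
  simp only [Matrix.mulVec, dotProduct, colScale, Matrix.of_apply]
  refine Finset.sum_congr rfl fun j _ => ?_
  have : l2norm (Z.col j) ≠ 0 := fun h0 => hZ j (l2norm_eq_zero.1 h0)
  rw [h]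
  field_simp

lemma signal_eq_signalS {X : Matrix (Fin n) (Fin p) ℝ} (hX : ∀ j, X.col j ≠ 0)
    (hX2 : ∀ jk, (interactions X).col jk ≠ 0) {b bs : Fin p → ℝ}
    {Φ Φs : Matrix (Fin p) (Fin p) ℝ} (hb : ∀ j, bs j = b j * l2norm (X.col j))
    (hΦ : ∀ k j, Φs k j = Φ k j * l2norm ((interactions X).col (j, k))) :
    signal X b Φ = signalS X bs Φs := by
  rw [signal, signalS, mainS, interactionsS, mulVec_eq_colScale_mulVec X hX hb,
    mulVec_eq_colScale_mulVec (interactions X) hX2 (v := Φ.vec) (vs := Φs.vec) fun jk => hΦ jk.2 jk.1]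

lemma signal_eq_signalS_scale {X : Matrix (Fin n) (Fin p) ℝ} (hX : ∀ j, X.col j ≠ 0)
    (hX2 : ∀ jk, (interactions X).col jk ≠ 0) (b : Fin p → ℝ) (Φ : Matrix (Fin p) (Fin p) ℝ) :
    signal X b Φ = signalS X (scaleMain X b) (scaleInter X Φ) :=
  signal_eq_signalS hX hX2 (fun _ => rfl) fun _ _ => rfl

lemma signal_unscale {X : Matrix (Fin n) (Fin p) ℝ} (hX : ∀ j, X.col j ≠ 0)
    (hX2 : ∀ jk, (interactions X).col jk ≠ 0) (bs : Fin p → ℝ) (Φs : Matrix (Fin p) (Fin p) ℝ) :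
    signal X (unscaleMain X bs) (unscaleInter X Φs) = signalS X bs Φs :=
  signal_eq_signalS hX hX2
    (fun j => (div_mul_cancel₀ _ fun h0 => hX j (l2norm_eq_zero.1 h0)).symm)
    fun k j => (div_mul_cancel₀ _ fun h0 => hX2 (j, k) (l2norm_eq_zero.1 h0)).symm

lemma signal_sub (X : Matrix (Fin n) (Fin p) ℝ) (b b' : Fin p → ℝ)
    (Φ Φ' : Matrix (Fin p) (Fin p) ℝ) :
    signal X (b - b') (Φ - Φ') = signal X b Φ - signal X b' Φ' := by
  simp only [signal, Matrix.vec_sub, Matrix.mulVec_sub]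
  abel

lemma predM_sub (X : Matrix (Fin n) (Fin p) ℝ) (b b' : Fin p → ℝ)
    (Φ Φ' : Matrix (Fin p) (Fin p) ℝ) :
    predM X (b - b') (Φ - Φ') = l2norm (signal X b Φ - signal X b' Φ') ^ 2 := by
  rw [predM, signal_sub]

lemma predM_sub_comm (X : Matrix (Fin n) (Fin p) ℝ) (b b' : Fin p → ℝ)
    (Φ Φ' : Matrix (Fin p) (Fin p) ℝ) :
    predM X (b - b') (Φ - Φ') = predM X (b' - b) (Φ' - Φ) := by
  rw [predM_sub, predM_sub, ← neg_sub, l2norm_neg]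

/-- Supports depend only on the zero pattern, which scaling by nonzero column norms leaves
unchanged. -/
lemma Je_congr {Φ Φ' : Matrix (Fin p) (Fin p) ℝ} (h : ∀ k j, Φ k j = 0 ↔ Φ' k j = 0) :
    Je Φ = Je Φ' := by
  ext jk
  rw [mem_Je, mem_Je]
  exact not_congr (h jk.2 jk.1)

lemma l2norm_col_concat_eq_zero (b : Fin p → ℝ) (Φ : Matrix (Fin p) (Fin p) ℝ) (j : Fin p) :
    l2norm ((concat b Φ).col j) = 0 ↔ b j = 0 ∧ ∀ k, Φ k j = 0 := by
  rw [l2norm_eq_zero, funext_iff]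
  constructor
  · intro h
    exact ⟨h (Sum.inl ()), fun k => h (Sum.inr k)⟩
  · rintro ⟨h1, h2⟩ (i | k)
    · exact h1
    · exact h2 k

lemma JG_congr {b b' : Fin p → ℝ} {Φ Φ' : Matrix (Fin p) (Fin p) ℝ}
    (hb : ∀ j, b j = 0 ↔ b' j = 0) (h : ∀ k j, Φ k j = 0 ↔ Φ' k j = 0) :
    JG b Φ = JG b' Φ' := by
  ext j
  rw [mem_JG, mem_JG, Ne, Ne, l2norm_col_concat_eq_zero, l2norm_col_concat_eq_zero, hb]
  simp only [h]

section Scale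

variable {X : Matrix (Fin n) (Fin p) ℝ}

lemma scaleMain_eq_zero_iff (hX : ∀ j, X.col j ≠ 0) (b : Fin p → ℝ) (j : Fin p) :
    scaleMain X b j = 0 ↔ b j = 0 := by
  have : l2norm (X.col j) ≠ 0 := fun h0 => hX j (l2norm_eq_zero.1 h0)
  simp [scaleMain, this]

lemma scaleInter_eq_zero_iff (hX2 : ∀ jk, (interactions X).col jk ≠ 0)
    (Φ : Matrix (Fin p) (Fin p) ℝ) (k j : Fin p) : scaleInter X Φ k j = 0 ↔ Φ k j = 0 := by
  have : l2norm ((interactions X).col (j, k)) ≠ 0 := fun h0 => hX2 (j, k) (l2norm_eq_zero.1 h0)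
  simp [scaleInter, this]

lemma unscaleMain_eq_zero_iff (hX : ∀ j, X.col j ≠ 0) (b : Fin p → ℝ) (j : Fin p) :
    unscaleMain X b j = 0 ↔ b j = 0 := by
  have : l2norm (X.col j) ≠ 0 := fun h0 => hX j (l2norm_eq_zero.1 h0)
  simp [unscaleMain, this]

lemma unscaleInter_eq_zero_iff (hX2 : ∀ jk, (interactions X).col jk ≠ 0)
    (Φ : Matrix (Fin p) (Fin p) ℝ) (k j : Fin p) : unscaleInter X Φ k j = 0 ↔ Φ k j = 0 := by
  have : l2norm ((interactions X).col (j, k)) ≠ 0 := fun h0 => hX2 (j, k) (l2norm_eq_zero.1 h0)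
  simp [unscaleInter, this]

end Scale

/-! ### Measurability and integrability -/

section Measurability

variable {Ω : Type*} [MeasurableSpace Ω] {P : Measure Ω} {bh : Ω → Fin p → ℝ}
  {Φh : Ω → Matrix (Fin p) (Fin p) ℝ}

lemma aemeasurable_l2norm {ι : Type*} [Fintype ι] {v : Ω → ι → ℝ}
    (hv : ∀ i, AEMeasurable (fun ω => v ω i) P) : AEMeasurable (fun ω => l2norm (v ω)) P :=
  continuous_l2norm.measurable.comp_aemeasurable (aemeasurable_pi_lambda _ hv)

lemma aemeasurable_signalS (X : Matrix (Fin n) (Fin p) ℝ)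
    (hb : ∀ j, AEMeasurable (fun ω => bh ω j) P)
    (hΦ : ∀ j k, AEMeasurable (fun ω => Φh ω j k) P) (i : Fin n) :
    AEMeasurable (fun ω => signalS X (bh ω) (Φh ω) i) P := by
  simp only [signalS, Matrix.mulVec, dotProduct, Pi.add_apply]
  refine AEMeasurable.add ?_ ?_
  · exact Finset.aemeasurable_fun_sum _ fun j _ => (hb j).const_mul _
  · exact Finset.aemeasurable_fun_sum _ fun jk _ => (hΦ jk.2 jk.1).const_mul _

lemma aemeasurable_indicator_ne_zero {f : Ω → ℝ} (hf : AEMeasurable f P) :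
    AEMeasurable (fun ω => if f ω = 0 then (0 : ℝ) else 1) P := by
  have h : Measurable fun x : ℝ => if x = 0 then (0 : ℝ) else 1 :=
    Measurable.ite (measurableSet_singleton 0) measurable_const measurable_const
  exact h.comp_aemeasurable hf

lemma integrable_card_Je [IsFiniteMeasure P] (hΦ : ∀ j k, AEMeasurable (fun ω => Φh ω j k) P) :
    Integrable (fun ω => ((Je (Φh ω)).card : ℝ)) P := by
  refine Integrable.of_bound (C := Fintype.card (Fin p × Fin p)) ?_
    (Filter.Eventually.of_forall fun ω => ?_)
  · simp_rw [← sum_ne_zero_eq_card_Je]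
    exact (Finset.aemeasurable_fun_sum _ fun j _ => Finset.aemeasurable_fun_sum _ fun k _ =>
      aemeasurable_indicator_ne_zero (hΦ k j)).aestronglyMeasurable
  · rw [Real.norm_natCast]
    exact_mod_cast Finset.card_le_univ _

lemma integrable_card_JG [IsFiniteMeasure P] (hb : ∀ j, AEMeasurable (fun ω => bh ω j) P)
    (hΦ : ∀ j k, AEMeasurable (fun ω => Φh ω j k) P) :
    Integrable (fun ω => ((JG (bh ω) (Φh ω)).card : ℝ)) P := by
  refine Integrable.of_bound (C := Fintype.card (Fin p)) ?_
    (Filter.Eventually.of_forall fun ω => ?_)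
  · simp_rw [← sum_ne_zero_eq_card_JG]
    refine (Finset.aemeasurable_fun_sum _ fun j _ => aemeasurable_indicator_ne_zero
      (aemeasurable_l2norm ?_)).aestronglyMeasurable
    rintro (i | k)
    · exact hb j
    · exact hΦ k j
  · rw [Real.norm_natCast]
    exact_mod_cast Finset.card_le_univ _

lemma noiseRem_integrable_and_integral_le {ι : Type*} [Fintype ι] (Z : Matrix (Fin n) ι ℝ)
    {σ : ℝ} (hσ : 0 < σ) (τ : ℝ) (hτ : Fintype.card ι * (√2 * Real.exp (-(2 * τ))) ≤ 1)
    {ε : Ω → Fin n → ℝ}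
    (hε : HasLaw ε (Measure.pi fun _ : Fin n => gaussianReal 0 (Real.toNNReal (σ ^ 2))) P) :
    Integrable (fun ω => noiseRem Z σ τ (ε ω)) P ∧
      ∫ ω, noiseRem Z σ τ (ε ω) ∂P ≤ 12 * σ ^ 2 := by
  have hm := (continuous_noiseRem Z σ τ).measurable
  have hme : AEMeasurable (fun ω => noiseRem Z σ τ (ε ω)) P := hm.comp_aemeasurable hε.aemeasurable
  have h0 : 0 ≤ᵐ[P] fun ω => noiseRem Z σ τ (ε ω) :=
    Filter.Eventually.of_forall fun ω => noiseRem_nonneg Z σ τ _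
  have hl : ∫⁻ ω, ENNReal.ofReal (noiseRem Z σ τ (ε ω)) ∂P ≤ ENNReal.ofReal (12 * σ ^ 2) := by
    refine le_of_eq_of_le ?_ (lintegral_noiseRem_le Z hσ τ hτ)
    exact hε.lintegral_comp hm.ennreal_ofReal.aemeasurable
  refine ⟨⟨hme.aestronglyMeasurable, ?_⟩, ?_⟩
  · rw [hasFiniteIntegral_iff_ofReal h0]
    exact hl.trans_lt ENNReal.ofReal_lt_top
  · rw [integral_eq_lintegral_of_nonneg_ae h0 hme.aestronglyMeasurable]
    exact ENNReal.toReal_le_of_le_ofReal (by positivity) hl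

end Measurability

end Gresh

/-! ### Expectations of the pointwise bounds -/

theorem theorem2 :
    ∃ A₀ : ℝ, 0 < A₀ ∧ ∀ A₁ A₂ : ℝ, A₀ ≤ A₁ → A₀ ≤ A₂ →
    ∃ C : ℝ, 0 < C ∧
    ∀ (n p : ℕ), 1 ≤ p →
    ∀ (X : Matrix (Fin n) (Fin p) ℝ),
    -- no term of the quadratic model vanishes, so that every column can be scaled to norm one
    (∀ j, X.col j ≠ 0) → (∀ jk, (Gresh.interactions X).col jk ≠ 0) →
    ∀ (σ : ℝ), 0 < σ →
    ∀ (bstar : Fin p → ℝ) (Φstar : Matrix (Fin p) (Fin p) ℝ)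
      (Ω : Type*) [MeasurableSpace Ω] (P : Measure Ω) [IsProbabilityMeasure P]
      (ε : Ω → Fin n → ℝ),
    -- the noise has the distribution `N(0, σ² I)`
    HasLaw ε (Measure.pi fun _ : Fin n => gaussianReal 0 (Real.toNNReal (σ ^ 2))) P →
    ∀ (bhatS : Ω → Fin p → ℝ) (ΦhatS : Ω → Matrix (Fin p) (Fin p) ℝ),
    (∀ j, AEMeasurable (fun ω => bhatS ω j) P) →
    (∀ j k, AEMeasurable (fun ω => ΦhatS ω j k) P) →
    -- the scaled estimate is a global minimizer for `y = X b* + X̄ vec(Φ*) + ε`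
    (∀ᵐ ω ∂P, Gresh.IsTypeBMinimizer X (Gresh.signal X bstar Φstar + ε ω)
      (A₁ * σ * √(Real.log (Real.exp 1 * p))) (A₂ * σ * √(Real.log (Real.exp 1 * p)))
      (bhatS ω) (ΦhatS ω)) →
    ∀ (b : Fin p → ℝ) (Φ : Matrix (Fin p) (Fin p) ℝ), Φ = Φᵀ →
    ∀ (ϑ κ : ℝ), 0 ≤ ϑ → max A₁ A₂ ≤ (1 + ϑ) * min A₁ A₂ → 0 < κ →
    Gresh.REScaled X (Gresh.Je Φ) (Gresh.JG b Φ) ϑ κ →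
    -- the prediction oracle inequality
    (2 ≤ p →
      Integrable (fun ω => Gresh.predM X (Gresh.unscaleMain X (bhatS ω) - bstar)
        (Gresh.unscaleInter X (ΦhatS ω) - Φstar)) P ∧
      ∫ ω, Gresh.predM X (Gresh.unscaleMain X (bhatS ω) - bstar)
          (Gresh.unscaleInter X (ΦhatS ω) - Φstar) ∂P ≤
        C * (Gresh.predM X (b - bstar) (Φ - Φstar) +
          max 1 (1 / κ) * σ ^ 2 *
            (((Gresh.Je Φ).card : ℝ) + ((Gresh.JG b Φ).card : ℝ)) * Real.log p +
          σ ^ 2)) ∧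
    -- the cardinality bound
    Integrable (fun ω => ((Gresh.Je (Gresh.unscaleInter X (ΦhatS ω))).card : ℝ)) P ∧
    Integrable (fun ω => ((Gresh.JG (Gresh.unscaleMain X (bhatS ω))
      (Gresh.unscaleInter X (ΦhatS ω))).card : ℝ)) P ∧
    (∫ ω, ((Gresh.Je (Gresh.unscaleInter X (ΦhatS ω))).card : ℝ) ∂P) +
        (∫ ω, ((Gresh.JG (Gresh.unscaleMain X (bhatS ω))
          (Gresh.unscaleInter X (ΦhatS ω))).card : ℝ) ∂P) ≤
      C * ((Gresh.predM X (bstar - b) (Φstar - Φ) + σ ^ 2) /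
          (σ ^ 2 * Real.log (Real.exp 1 * p)) +
        max 1 (1 / κ) * (((Gresh.Je Φ).card : ℝ) + ((Gresh.JG b Φ).card : ℝ))) := by
  -- In C, 60 = 5·12 comes from 5 E R, and 12 = 4·3 from the factor 4 of `oracle_le` and τ ≤ 3 log p
  -- for p ≥ 2.
  refine ⟨26, by norm_num, fun A₁ A₂ hA₁ hA₂ => ⟨60 + 12 * (8 + max A₁ A₂ ^ 2), by positivity, ?_⟩⟩
  intro n p hp X hX hX2 σ hσ bstar Φstar Ω _ P _ ε hε bhatS ΦhatS hbm hΦm hmin b Φ hΦ ϑ κ _ hϑ hκ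
    hRE
  set c := 8 + max A₁ A₂ ^ 2 with hc
  have hc8 : 8 ≤ c := by rw [hc]; nlinarith [sq_nonneg (max A₁ A₂)]
  set τ := Real.log (Real.exp 1 * p) with hτdef
  have hp' : (1 : ℝ) ≤ p := by exact_mod_cast hp
  have hτlog : τ = 1 + Real.log p := by
    rw [hτdef, Real.log_mul (Real.exp_pos 1).ne' (by positivity), Real.log_exp]
  have hlog0 : 0 ≤ Real.log p := Real.log_nonneg hp'
  have hτ : 0 < τ := by linarith
  have hK := Gresh.specNorm_fullS_pos hp hX
  set R : Ω → ℝ := fun ω => Gresh.noiseRem (Gresh.fullS X) σ τ (ε ω) with hR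
  obtain ⟨hRint, hRle⟩ := Gresh.noiseRem_integrable_and_integral_le (Gresh.fullS X) hσ τ
    (Gresh.card_mul_exp_log_le_one hp) hε
  -- pass to the scaled coefficients
  have hJe : Gresh.Je (Gresh.scaleInter X Φ) = Gresh.Je Φ :=
    Gresh.Je_congr (Gresh.scaleInter_eq_zero_iff hX2 Φ)
  have hJG : Gresh.JG (Gresh.scaleMain X b) (Gresh.scaleInter X Φ) = Gresh.JG b Φ :=
    Gresh.JG_congr (Gresh.scaleMain_eq_zero_iff hX b) (Gresh.scaleInter_eq_zero_iff hX2 Φ)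
  have hJeh : ∀ ω, Gresh.Je (Gresh.unscaleInter X (ΦhatS ω)) = Gresh.Je (ΦhatS ω) := fun ω =>
    Gresh.Je_congr (Gresh.unscaleInter_eq_zero_iff hX2 _)
  have hJGh : ∀ ω, Gresh.JG (Gresh.unscaleMain X (bhatS ω)) (Gresh.unscaleInter X (ΦhatS ω)) =
      Gresh.JG (bhatS ω) (ΦhatS ω) := fun ω =>
    Gresh.JG_congr (Gresh.unscaleMain_eq_zero_iff hX _) (Gresh.unscaleInter_eq_zero_iff hX2 _)
  rw [← hJe, ← hJG] at hRE
  have hpred : ∀ ω, Gresh.predM X (Gresh.unscaleMain X (bhatS ω) - bstar)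
      (Gresh.unscaleInter X (ΦhatS ω) - Φstar) =
      Gresh.l2norm (Gresh.signalS X (bhatS ω) (ΦhatS ω) - Gresh.signal X bstar Φstar) ^ 2 := by
    intro ω
    rw [Gresh.predM_sub, Gresh.signal_unscale hX hX2]
  have hD : Gresh.predM X (b - bstar) (Φ - Φstar) =
      Gresh.l2norm (Gresh.signalS X (Gresh.scaleMain X b) (Gresh.scaleInter X Φ) -
        Gresh.signal X bstar Φstar) ^ 2 := by
    rw [Gresh.predM_sub, Gresh.signal_eq_signalS_scale hX hX2 b Φ]
  rw [Gresh.predM_sub_comm X bstar b]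
  simp_rw [hpred, hJeh, hJGh]
  have hD0 : 0 ≤ Gresh.predM X (b - bstar) (Φ - Φstar) := sq_nonneg _
  set D := Gresh.predM X (b - bstar) (Φ - Φstar)
  set M : Ω → ℝ := fun ω =>
    Gresh.l2norm (Gresh.signalS X (bhatS ω) (ΦhatS ω) - Gresh.signal X bstar Φstar) ^ 2 with hM
  have hJ0 : (0 : ℝ) ≤ (Gresh.Je Φ).card + (Gresh.JG b Φ).card :=
    add_nonneg (Nat.cast_nonneg _) (Nat.cast_nonneg _)
  -- the pointwise bounds
  have hMle : ∀ᵐ ω ∂P, M ω ≤ 2 * D + 5 * R ω +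
      4 * c * (max 1 (1 / κ) * (σ ^ 2 * τ * ((Gresh.Je Φ).card + (Gresh.JG b Φ).card))) := by
    filter_upwards [hmin] with ω hω
    have h := hω.oracle_le hA₁ hA₂ hσ hτ hK (Gresh.scaleInter_symm X hΦ) hϑ hκ hRE
    rwa [← hD, hJe, hJG] at h
  have hcardle : ∀ᵐ ω ∂P, σ ^ 2 * τ * ((Gresh.Je (ΦhatS ω)).card +
      (Gresh.JG (bhatS ω) (ΦhatS ω)).card) ≤ 1 / 32 * (M ω + R ω) := by
    filter_upwards [hmin] with ω hω
    exact hω.card_le hA₁ hA₂ hσ hτ hK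
  set J : ℝ := (Gresh.Je Φ).card + (Gresh.JG b Φ).card
  set L := max 1 (1 / κ)
  have hL : 1 ≤ L := le_max_left _ _
  clear_value J L D c
  set T := 4 * c * (L * (σ ^ 2 * τ * J)) with hT
  have hMint : Integrable M P := by
    refine Integrable.mono' (((integrable_const (2 * D)).add (hRint.const_mul 5)).add
      (integrable_const T)) ?_ ?_
    · refine ((Gresh.aemeasurable_l2norm fun i => ?_).pow_const 2).aestronglyMeasurable
      exact (Gresh.aemeasurable_signalS X hbm hΦm i).sub_const _
    · filter_upwards [hMle] with ω hω
      rw [Real.norm_of_nonneg (sq_nonneg _)]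
      exact hω
  have hMintle : ∫ ω, M ω ∂P ≤ 2 * D + 60 * σ ^ 2 + T := by
    have h1 : ∫ ω, M ω ∂P ≤ ∫ ω, (2 * D + 5 * R ω + T) ∂P := integral_mono_ae hMint (((integrable_const (2 * D)).add (hRint.const_mul 5)).add
      (integrable_const T)) hMle
    have h2 : ∫ ω, (2 * D + 5 * R ω + T) ∂P =
        2 * D + 5 * ∫ ω, R ω ∂P + T := by
      have hR5 : Integrable (fun ω => 5 * R ω) P := hRint.const_mul 5
      have hDR : Integrable (fun ω => 2 * D + 5 * R ω) P := (integrable_const _).add hR5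
      rw [integral_add hDR (integrable_const _), integral_add (integrable_const _) hR5,
        integral_const_mul 5 R]
      simp
    refine h1.trans (h2.le.trans ?_)
    linarith
  have hJeint := Gresh.integrable_card_Je (P := P) hΦm
  have hJGint := Gresh.integrable_card_JG (P := P) hbm hΦm
  have hσ2 : 0 < σ ^ 2 := by positivity
  refine ⟨fun hp2 => ⟨hMint, hMintle.trans ?_⟩, hJeint, hJGint, ?_⟩
  -- Since τ = 1 + log p, passing from τ to log p needs log p bounded away from 0; hence p ≥ 2.
  · have hlog : (1 : ℝ) / 2 ≤ Real.log p := by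
      have h1 := Real.log_two_gt_d9
      have h2 : Real.log 2 ≤ Real.log p :=
        Real.log_le_log (by norm_num) (by exact_mod_cast hp2)
      linarith
    have hτ3 : τ ≤ 3 * Real.log p := by linarith
    have h3 : T ≤ 12 * c * (L * σ ^ 2 * J * Real.log p) := by
      calc T = 4 * c * (L * σ ^ 2 * J) * τ := by rw [hT]; ring
        _ ≤ 4 * c * (L * σ ^ 2 * J) * (3 * Real.log p) := by gcongr
        _ = _ := by ring
    have h4 : 0 ≤ L * σ ^ 2 * J * Real.log p := by positivity
    nlinarith
  · have h1 : σ ^ 2 * τ * ((∫ ω, ((Gresh.Je (ΦhatS ω)).card : ℝ) ∂P) +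
        ∫ ω, ((Gresh.JG (bhatS ω) (ΦhatS ω)).card : ℝ) ∂P) ≤
        1 / 32 * (∫ ω, M ω ∂P + ∫ ω, R ω ∂P) := by
      rw [← integral_add hJeint hJGint, ← integral_const_mul, ← integral_add hMint hRint,
        ← integral_const_mul]
      exact integral_mono_ae ((hJeint.add hJGint).const_mul _) ((hMint.add hRint).const_mul _)
        hcardle
    have hx : 0 < σ ^ 2 * τ := by positivity
    -- Clearing σ²τ leaves (E M + E R)/32, at most (2D + 72σ² + T)/32, which C covers amply.
    refine le_of_mul_le_mul_left (h1.trans ?_) hx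
    have h2 : σ ^ 2 * τ * ((60 + 12 * c) * ((D + σ ^ 2) / (σ ^ 2 * τ) + L * J)) =
        (60 + 12 * c) * (D + σ ^ 2 + L * (σ ^ 2 * τ * J)) := by
      field_simp
    rw [h2]
    have h3 : 0 ≤ L * (σ ^ 2 * τ * J) := by positivity
    have h4 : T = 4 * c * (L * (σ ^ 2 * τ * J)) := hT
    nlinarith
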